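/- Let $a,b\in\mathbb R$, $\sigma\neq 0$, $\tau>0$, let $\phi:[-\tau,0]\to\mathbb R$ be continuous, let $w$ be a standard Wiener process, and let $x(t)$, $t\ge-\tau$, be a continuous solution of the linear stochastic delay equation $$dx(t)=(a\,x(t)+b\,x(t-\tau))\,dt+\sigma\,dw(t),\quad t\ge 0,\qquad x(t)=\phi(t),\quad t\in[-\tau,0].$$ Put $X(t)=0$ for $t<0$ and $X(t)=\sum_{k=0}^{\lfloor t/\tau\rfloor}e^{a(t-k\tau)}\frac{b^k}{k!}(t-k\tau)^k$ for $t\ge0$; put $S(t)=\phi(t)$ for $-\tau\le t<0$ and $S(t)=X(t)\phi(0)+b\int_{-\tau}^0X(t-q-\tau)\phi(q)\,dq$ for $t\ge 0$. For $t\ge 0$ and $s_1,s_2\in[-\tau,0]$ let $r_t(s_1,s_2)=\sigma^2\int_0^{t+\min\{s_1,s_2\}}X(q)X(q+|s_2-s_1|)\,dq$ if $t+\min\{s_1,s_2\}>0$, and $r_t(s_1,s_2)=0$ otherwise. Let $\upsilon(t)=r_t(0,0)$ and $$Q_t=\begin{pmatrix} r_t(0,0)&r_t(0,-\tau)\\ r_t(-\tau,0)&r_t(-\tau,-\tau)\end{pmatrix}.$$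 Then the following hold. 1. $X$ is the fundamental solution of $x'(t)=ax(t)+bx(t-\tau)$ ($X=0$ on $(-\infty,0)$, $X(0)=1$, $X$ is continuous on $[0,\infty)$ and satisfies the equation for $t>0$, $t\neq\tau$), and $S$ is its solution with $S=\phi$ on $[-\tau,0]$ (continuous on $[-\tau,\infty)$, satisfying the equation for all $t>0$). Moreover $\mathbb E\,x(t)=S(t)$ for $t\ge-\tau$, and $\mathrm{cov}(x(t+s_1),x(t+s_2))=r_t(s_1,s_2)$ for $t\ge0$ and $s_1,s_2\in[-\tau,0]$. 2. For every $t>0$, $\upsilon(t)>0$ and $x(t)$ has the Gaussian density $p(x,t)=\frac1{\sqrt{2\pi\upsilon(t)}}\exp\{-\frac{(x-S(t))^2}{2\upsilon(t)}\}$. 3. For every $t\ge 0$ the pair $(x(t),x(t-\tau))$ is Gaussian (possibly degenerate), and it has a density with respect to Lebesgue measure on $\mathbb R^2$ if and only if $t>\tau$. If $t\le\tau$ then $\det Q_t=0$. If $t>\tau$ then $$r_t(-\tau,0)^2\le\upsilon(t-\tau)(\upsilon(t)-\upsilon(\tau))<\upsilon(t-\tau)\upsilon(t),$$ so $\det Q_t>0$,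 and the density of the pair is the nondegenerate Gaussian density $p_\nu(x,y,t)$ with mean $(S(t),S(t-\tau))$ and covariance matrix $Q_t$. 4. Let $t>\tau$. The conditional density $p_\nu(x,y,t)/p(x,t)$ of $x(t-\tau)$ given $x(t)=x$ is Gaussian with variance $\det Q_t/\upsilon(t)$ and mean $$m_|(x,t)=S(t-\tau)+\frac{r_t(-\tau,0)}{\upsilon(t)}\,(x-S(t)),$$ and $\mathbb E[x(t-\tau)\mid x(t)]=m_|(x(t),t)$ almost surely. 5. For all $t>\tau$ and $x\in\mathbb R$, $p$ satisfies, in the classical sense, $$\partial_tp=-\partial_x(a\,x\,p)-\partial_x\int_{\mathbb R}b\,y\,p_\nu(x,y,t)\,dy+\tfrac12\partial_x^2(\sigma^2p)$$ and the closed equation $$\partial_tp=-\partial_x\big([a\,x+b\,m_|(x,t)]\,p\big)+\tfrac12\,\partial_x^2(\sigma^2p).\tag{$*$}$$ 6. For all $t>\tau$, $$\frac{d}{dt}\upsilon(t)=2a\,\upsilon(t)+2b\,r_t(-\tau,0)+\sigma^2,\tag{$**$}$$ and $(*)$ is equivalent to $(**)$ in the following sense: for every function $v$ that is positive on $(\tau,\infty)$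 and every $t>\tau$, the Gaussian density with mean $S(t)$ and variance $v(t)$ satisfies $(*)$ at time $t$ for all $x$, with $m_|$ formed with $v$ in the place of $\upsilon$, if and only if $v$ is differentiable at $t$ with $v'(t)=2a\,v(t)+2b\,r_t(-\tau,0)+\sigma^2$. -/

import Mathlib

open MeasureTheory ProbabilityTheory Set
open scoped NNReal ENNReal

noncomputable section

namespace LinearSDDE

/-- `x` is a solution of `dx(t) = (a x(t) + b x(t - τ)) dt + σ dw(t)`, `t ≥ 0`, with deterministic
initial segment `x(t) = φ(t)`, `t ∈ [-τ, 0]`. As the noise is additive, the stochastic integral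
is `∫₀ᵗ σ dw = σ w(t)` and the equation is the pathwise integral equation `eqn`. Only the values
`x t` with `t ≥ -τ` matter. -/
structure IsSolution {Ω : Type*} [MeasurableSpace Ω] (P : Measure Ω) (w : ℝ≥0 → Ω → ℝ)
    (a b σ τ : ℝ) (φ : ℝ → ℝ) (x : ℝ → Ω → ℝ) : Prop where
  measurable : ∀ t, -τ ≤ t → Measurable (x t)
  continuous_paths : ∀ᵐ ω ∂P, ContinuousOn (fun t => x t ω) (Ici (-τ))
  initial : ∀ᵐ ω ∂P, ∀ t ∈ Icc (-τ) 0, x t ω = φ t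
  eqn : ∀ᵐ ω ∂P, ∀ t : ℝ≥0,
    x t ω = φ 0 + (∫ s in (0 : ℝ)..t, (a * x s ω + b * x (s - τ) ω)) + σ * w t ω

/-- The fundamental solution `X` of `x'(t) = a x(t) + b x(t - τ)`:
`X(t) = ∑_{k=0}^{⌊t/τ⌋} e^{a(t-kτ)} b^k (t-kτ)^k / k!` for `t ≥ 0`, and `X(t) = 0` for `t < 0`. -/
def X (a b τ t : ℝ) : ℝ :=
  if t < 0 then 0
  else ∑ k ∈ Finset.range (⌊t / τ⌋₊ + 1),
    Real.exp (a * (t - k * τ)) * (b ^ k / (k.factorial : ℝ)) * (t - k * τ) ^ k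

/-- The solution of the noiseless equation with initial function `φ`, so that
`S_t φ (s) = S a b τ φ (t + s)` for `t ≥ 0`, `s ∈ [-τ, 0]`. -/
def S (a b τ : ℝ) (φ : ℝ → ℝ) (t : ℝ) : ℝ :=
  if t < 0 then φ t
  else X a b τ t * φ 0 + b * ∫ q in (-τ)..0, X a b τ (t - q - τ) * φ q

/-- The covariance function `r_t(s₁, s₂)` of the segment `x_t(s) = x(t + s)`, `s ∈ [-τ, 0]`. -/
def r (a b σ τ t s₁ s₂ : ℝ) : ℝ :=
  if t + min s₁ s₂ ≤ 0 then 0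
  else σ ^ 2 * ∫ q in (0 : ℝ)..(t + min s₁ s₂), X a b τ q * X a b τ (q + |s₂ - s₁|)

/-- The variance `υ(t) = r_t(0, 0)`. -/
def υ (a b σ τ t : ℝ) : ℝ := r a b σ τ t 0 0

/-- The covariance matrix `Q_t` of `(x(t), x(t - τ))`. -/
def Q (a b σ τ t : ℝ) : Matrix (Fin 2) (Fin 2) ℝ :=
  !![r a b σ τ t 0 0, r a b σ τ t 0 (-τ); r a b σ τ t (-τ) 0, r a b σ τ t (-τ) (-τ)]

/-- The Gaussian density `p(ξ, t)` with mean `S_t φ (0)` and variance `υ(t)`. -/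
def p (a b σ τ : ℝ) (φ : ℝ → ℝ) (t ξ : ℝ) : ℝ :=
  gaussianPDFReal (S a b τ φ t) (υ a b σ τ t).toNNReal ξ

/-- The bivariate Gaussian density `p_ν(ξ, η, t)` with mean `(S_t φ (0), S_t φ (-τ))` and
covariance matrix `Q_t` (meaningful when `det Q_t > 0`). -/
def pν (a b σ τ : ℝ) (φ : ℝ → ℝ) (t ξ η : ℝ) : ℝ :=
  let z : Fin 2 → ℝ := ![ξ - S a b τ φ t, η - S a b τ φ (t - τ)]
  (2 * Real.pi * √(Q a b σ τ t).det)⁻¹ *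
    Real.exp (-(z ⬝ᵥ ((Q a b σ τ t)⁻¹).mulVec z) / 2)

/-- The density `p_ν(η, t - τ | ξ, t)` of `x(t - τ)` conditional on `x(t) = ξ`. -/
def condDensity (a b σ τ : ℝ) (φ : ℝ → ℝ) (t ξ η : ℝ) : ℝ :=
  pν a b σ τ φ t ξ η / p a b σ τ φ t ξ

/-- The function `m_|(ξ, t)`, with a general function `v` in the place of the variance:
`S_t φ (-τ) + r_t(-τ, 0) / v(t) * (ξ - S_t φ (0))`. -/
def condMean (a b σ τ : ℝ) (φ : ℝ → ℝ) (v : ℝ → ℝ) (t ξ : ℝ) : ℝ :=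
  S a b τ φ (t - τ) + r a b σ τ t (-τ) 0 / v t * (ξ - S a b τ φ t)

/-- The function `f` satisfies, in the classical sense at the point `(ξ, t)`, the equation
`∂ₜ f = -∂ₓ (drift f) + (1/2) ∂ₓ² (σ² f)`. -/
def FokkerPlanckAt (drift : ℝ → ℝ → ℝ) (σ : ℝ) (f : ℝ → ℝ → ℝ) (t ξ : ℝ) : Prop :=
  ContDiffAt ℝ 2 (f t) ξ ∧ DifferentiableAt ℝ (fun z => drift t z * f t z) ξ ∧
  HasDerivAt (fun s => f s ξ)
    (-deriv (fun z => drift t z * f t z) ξ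
      + 1 / 2 * iteratedDeriv 2 (fun z => σ ^ 2 * f t z) ξ) t

end LinearSDDE

end

/-! The noise is additive, so the equation can be solved path by path. For a continuous path `W`
vanishing on `(-∞, 0]`, the solution is `S + σ · noise`, where `noise` at `t` is `W t + ∫₀ᵗ X'(t -
u) W u du`, the integrated-by-parts form of `∫ X(t - u) dW(u)` (`eq_S_add_noise`). Existence comes
from Fubini applied to the convolution with `X` (`duhamel_eq_integral`), uniqueness from the method
of steps and Gronwall (`eq_zero_of_eq_integral`).

Riemann sums present the noise as an almost sure limit of finite linear combinations of values of
`w`. These are Wiener integrals of step functions that converge boundedly to `X(t - ·)`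
(`isWienerLimit_noise`). Hence it is Gaussian with variance `∫ X(t - v)² dv`
(`IsWienerLimit.hasLaw`). Linear combinations give joint Gaussianity, and polarization gives the
covariance as an inner product of shifted copies of `X`, which is `r` up to the factor `σ²`.

For `t > τ`, Cauchy–Schwarz on `[0, t - τ]` loses the amount `υ(τ) > 0`, so the pair is
nondegenerate (`r_sq_le`, `det_Q_pos`); for `t ≤ τ` the delayed value is deterministic. The
regression residual is independent of `x t`, which yields the factorization of the joint density and
the conditional mean.

The joint density enters the evolution equation only through `∫ b η pν dη = b m_| p`, and `m_|` is
affine. The resulting drift equals `S'(t)` at the mean, so the mean part of the Fokker–Planck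
equation holds automatically and only the variance equation remains (`fokkerPlanckAt_gaussian_iff`).
That equation follows by expanding `X(t)² = 1 + ∫₀ᵗ 2 X X'` (`hasDerivAt_υ`). -/

namespace LinearSDDE

open Filter Topology

/-! ### The fundamental solution and its delay equation -/

section FundamentalSolution

/-- The summands of the fundamental solution, `X(t) = ∑ₖ term k (t - k τ)`. -/
noncomputable def term (a b : ℝ) (k : ℕ) (u : ℝ) : ℝ :=
  if u < 0 then 0 else Real.exp (a * u) * (b ^ k / (k.factorial : ℝ)) * u ^ k

variable {a b τ : ℝ}

lemma X_of_neg {t : ℝ} (ht : t < 0) : X a b τ t = 0 := if_pos ht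

lemma X_zero : X a b τ 0 = 1 := by simp [X]

/-- Surplus summands vanish because `term` is cut off at negative arguments. The number of summands
can thus be kept fixed near a point, where the floor may jump. -/
lemma X_eq_sum_term (hτ : 0 < τ) {N : ℕ} {t : ℝ} (ht : t < N * τ) :
    X a b τ t = ∑ k ∈ Finset.range N, term a b k (t - k * τ) := by
  rcases lt_or_ge t 0 with h | h
  · rw [X_of_neg h, eq_comm]
    refine Finset.sum_eq_zero fun k _ => if_pos ?_
    have : 0 ≤ (k : ℝ) * τ := by positivity
    linarith
  · have hN : ⌊t / τ⌋₊ + 1 ≤ N := (Nat.floor_lt (by positivity)).2 ((div_lt_iff₀ hτ).2 ht)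
    rw [X, if_neg h.not_gt]
    have hsub : Finset.range (⌊t / τ⌋₊ + 1) ⊆ Finset.range N := by simpa using hN
    rw [← Finset.sum_subset hsub]
    · refine Finset.sum_congr rfl fun k hk => ?_
      have hk' : k ≤ ⌊t / τ⌋₊ := by simpa [Nat.lt_succ_iff] using hk
      have := (le_div_iff₀ hτ).1 ((Nat.le_floor_iff (by positivity)).1 hk')
      rw [term, if_neg (by linarith)]
    · intro k _ hk
      have hk' : ⌊t / τ⌋₊ < k := by simpa [Nat.lt_succ_iff] using hk
      have := (div_lt_iff₀ hτ).1 ((Nat.floor_lt (by positivity)).1 hk')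
      exact if_pos (by linarith)

lemma hasDerivAt_exp_mul_pow_succ (k : ℕ) (u : ℝ) :
    HasDerivAt (fun u => Real.exp (a * u) * (b ^ (k + 1) / ((k + 1).factorial : ℝ)) * u ^ (k + 1))
      (a * (Real.exp (a * u) * (b ^ (k + 1) / ((k + 1).factorial : ℝ)) * u ^ (k + 1))
        + b * (Real.exp (a * u) * (b ^ k / (k.factorial : ℝ)) * u ^ k)) u := by
  have h1 : HasDerivAt (fun u => Real.exp (a * u)) (Real.exp (a * u) * a) u := by
    simpa using ((hasDerivAt_id u).const_mul a).exp
  have h2 := (h1.mul_const (b ^ (k + 1) / ((k + 1).factorial : ℝ))).mul (hasDerivAt_pow (k + 1) u)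
  refine h2.congr_deriv ?_
  rw [Nat.factorial_succ]
  push_cast
  field_simp
  ring

lemma term_of_nonpos {k : ℕ} {u : ℝ} (hu : u ≤ 0) : term a b (k + 1) u = 0 := by
  rcases hu.lt_or_eq with h | rfl
  · exact if_pos h
  · simp [term]

lemma term_of_nonneg {k : ℕ} {u : ℝ} (hu : 0 ≤ u) :
    term a b k u = Real.exp (a * u) * (b ^ k / (k.factorial : ℝ)) * u ^ k :=
  if_neg hu.not_gt

lemma hasDerivAt_term_zero {u : ℝ} (hu : u ≠ 0) :
    HasDerivAt (term a b 0) (a * term a b 0 u) u := by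
  rcases hu.lt_or_gt with h | h
  · rw [show term a b 0 u = 0 from if_pos h, mul_zero]
    refine (hasDerivAt_const u (0 : ℝ)).congr_of_eventuallyEq ?_
    filter_upwards [Iio_mem_nhds h] with s hs using if_pos hs
  · rw [term_of_nonneg h.le]
    have h1 : HasDerivAt (fun u => Real.exp (a * u)) (Real.exp (a * u) * a) u := by
      simpa using ((hasDerivAt_id u).const_mul a).exp
    refine (h1.congr_of_eventuallyEq ?_).congr_deriv (by simp [mul_comm])
    filter_upwards [Ioi_mem_nhds h] with s hs
    simp [term_of_nonneg (a := a) (b := b) (k := 0) (le_of_lt hs)]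

/-- For `k ≠ 0` the power `u ^ (k + 1)` has a zero of order at least two, so it glues differentiably
to `0` at the origin. For `k = 0` there is in general a corner, which is why `X` may fail to be
differentiable at `τ`. -/
lemma hasDerivAt_term_succ {k : ℕ} {u : ℝ} (hu : u ≠ 0 ∨ k ≠ 0) :
    HasDerivAt (term a b (k + 1)) (a * term a b (k + 1) u + b * term a b k u) u := by
  rcases lt_trichotomy u 0 with h | rfl | h
  · rw [show term a b (k + 1) u = 0 from if_pos h, show term a b k u = 0 from if_pos h,
      mul_zero, mul_zero, add_zero]
    refine (hasDerivAt_const u (0 : ℝ)).congr_of_eventuallyEq ?_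
    filter_upwards [Iio_mem_nhds h] with s hs using if_pos hs
  · obtain ⟨m, rfl⟩ := Nat.exists_eq_succ_of_ne_zero (hu.resolve_left (by simp))
    have h0 : term a b (m + 1) 0 = 0 := term_of_nonpos le_rfl
    have h1 : term a b (m + 1 + 1) 0 = 0 := term_of_nonpos le_rfl
    rw [Nat.succ_eq_add_one, h0, h1, mul_zero, mul_zero, add_zero]
    rw [← hasDerivWithinAt_univ, ← Iic_union_Ici (a := (0 : ℝ))]
    refine HasDerivWithinAt.union ?_ ?_
    · exact (hasDerivWithinAt_const _ _ (0 : ℝ)).congr (fun s hs => term_of_nonpos hs) h1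
    · have := (hasDerivAt_exp_mul_pow_succ (a := a) (b := b) (m + 1) 0).hasDerivWithinAt (s := Ici 0)
      refine (this.congr (fun s hs => term_of_nonneg hs) (term_of_nonneg le_rfl)).congr_deriv ?_
      simp
  · rw [term_of_nonneg h.le, term_of_nonneg h.le]
    refine (hasDerivAt_exp_mul_pow_succ k u).congr_of_eventuallyEq ?_
    filter_upwards [Ioi_mem_nhds h] with s hs using term_of_nonneg (le_of_lt hs)

lemma continuous_term_succ (k : ℕ) : Continuous (term a b (k + 1)) := by
  have : term a b (k + 1) = fun u =>
      Real.exp (a * u) * (b ^ (k + 1) / ((k + 1).factorial : ℝ)) * (max u 0) ^ (k + 1) := by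
    ext u
    rcases le_total u 0 with h | h
    · rw [term_of_nonpos h, max_eq_right h]; simp
    · rw [term_of_nonneg h, max_eq_left h]
  rw [this]
  fun_prop

lemma continuousOn_term_zero : ContinuousOn (term a b 0) (Ici 0) := by
  refine ContinuousOn.congr (f := fun u => Real.exp (a * u)) (by fun_prop) fun u hu => ?_
  simp [term_of_nonneg (a := a) (b := b) (k := 0) hu]

lemma exists_lt_succ_mul (hτ : 0 < τ) (t : ℝ) : ∃ N : ℕ, t < ((N + 1 : ℕ) : ℝ) * τ := by
  obtain ⟨N, hN⟩ := exists_nat_gt (t / τ)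
  refine ⟨N, ?_⟩
  rw [div_lt_iff₀ hτ] at hN
  push_cast
  linarith

lemma X_eventuallyEq (hτ : 0 < τ) {N : ℕ} {t : ℝ} (ht : t < ((N + 1 : ℕ) : ℝ) * τ) :
    X a b τ =ᶠ[𝓝 t] fun s =>
      (∑ k ∈ Finset.range N, term a b (k + 1) (s - (k + 1 : ℕ) * τ)) + term a b 0 s := by
  filter_upwards [Iio_mem_nhds ht] with s hs
  rw [X_eq_sum_term hτ hs, Finset.sum_range_succ']
  simp

/-- The fundamental solution satisfies the delay equation except at `0` and `τ`. -/
lemma hasDerivAt_X (hτ : 0 < τ) {t : ℝ} (h0 : t ≠ 0) (h1 : t ≠ τ) :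
    HasDerivAt (X a b τ) (a * X a b τ t + b * X a b τ (t - τ)) t := by
  obtain ⟨N, hN⟩ := exists_lt_succ_mul hτ t
  have hX := X_eventuallyEq (a := a) (b := b) hτ hN
  have hd : HasDerivAt (fun s =>
      (∑ k ∈ Finset.range N, term a b (k + 1) (s - (k + 1 : ℕ) * τ)) + term a b 0 s)
      ((∑ k ∈ Finset.range N, (a * term a b (k + 1) (t - (k + 1 : ℕ) * τ)
        + b * term a b k (t - (k + 1 : ℕ) * τ))) + a * term a b 0 t) t := by
    refine HasDerivAt.add ?_ (hasDerivAt_term_zero h0)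
    refine HasDerivAt.fun_sum fun k _ => ?_
    refine HasDerivAt.comp_sub_const t _ (hasDerivAt_term_succ ?_)
    rcases eq_or_ne k 0 with rfl | hk
    · left
      simpa [sub_eq_zero] using h1
    · exact Or.inr hk
  refine (hd.congr_of_eventuallyEq hX).congr_deriv ?_
  rw [hX.eq_of_nhds, X_eq_sum_term (N := N) hτ (by push_cast at hN; linarith),
    Finset.sum_add_distrib, ← Finset.mul_sum, ← Finset.mul_sum]
  have : ∀ k : ℕ, t - τ - k * τ = t - (k + 1 : ℕ) * τ := fun k => by push_cast; ring
  simp only [this]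
  ring

lemma continuousOn_X (hτ : 0 < τ) : ContinuousOn (X a b τ) (Ici 0) := by
  intro t ht
  obtain ⟨N, hN⟩ := exists_lt_succ_mul hτ t
  have hX := X_eventuallyEq (a := a) (b := b) hτ hN
  refine ContinuousWithinAt.congr_of_eventuallyEq ?_ (hX.filter_mono nhdsWithin_le_nhds)
    hX.eq_of_nhds
  refine ContinuousWithinAt.add ?_ (continuousOn_term_zero t ht)
  refine Continuous.continuousWithinAt ?_
  refine continuous_finsetSum _ fun k _ => (continuous_term_succ k).comp (by fun_prop)

lemma measurable_X (hτ : 0 < τ) : Measurable (X a b τ) := by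
  have : X a b τ = (Ici 0).indicator (fun t => X a b τ (max t 0)) := by
    ext t
    by_cases h : 0 ≤ t
    · rw [indicator_of_mem (show t ∈ Ici 0 from h), max_eq_left h]
    · rw [indicator_of_notMem (show t ∉ Ici 0 from h), X_of_neg (not_le.1 h)]
  rw [this]
  refine Measurable.indicator (Continuous.measurable ?_) measurableSet_Ici
  exact (continuousOn_X hτ).comp_continuous (by fun_prop) (fun t => mem_Ici.2 (le_max_right _ _))

/-- `X` is bounded on every half-line `(-∞, T]`. -/
lemma exists_X_bound (a b : ℝ) (hτ : 0 < τ) (T : ℝ) : ∃ C, 0 ≤ C ∧ ∀ t ≤ T, |X a b τ t| ≤ C := by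
  obtain ⟨C, hC⟩ := isCompact_Icc.exists_bound_of_continuousOn
    ((continuousOn_X (a := a) (b := b) hτ).mono (Icc_subset_Ici_self : Icc 0 T ⊆ Ici 0))
  refine ⟨max C 0, le_max_right _ _, fun t ht => ?_⟩
  rcases lt_or_ge t 0 with h | h
  · simp [X_of_neg h]
  · exact (hC t ⟨h, ht⟩).trans (le_max_left _ _)

/-- The derivative of the fundamental solution. -/
noncomputable def kernel (a b τ t : ℝ) : ℝ := a * X a b τ t + b * X a b τ (t - τ)

lemma kernel_of_neg (hτ : 0 < τ) {t : ℝ} (ht : t < 0) : kernel a b τ t = 0 := by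
  rw [kernel, X_of_neg ht, X_of_neg (by linarith)]; simp

lemma measurable_kernel (hτ : 0 < τ) : Measurable (kernel a b τ) :=
  ((measurable_X hτ).const_mul a).add (((measurable_X hτ).comp (measurable_id.sub_const τ)).const_mul b)

lemma exists_kernel_bound (a b : ℝ) (hτ : 0 < τ) (T : ℝ) :
    ∃ C, 0 ≤ C ∧ ∀ t ≤ T, |kernel a b τ t| ≤ C := by
  obtain ⟨C, hC0, hC⟩ := exists_X_bound a b hτ T
  refine ⟨|a| * C + |b| * C, by positivity, fun t ht => ?_⟩
  refine (abs_add_le _ _).trans ?_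
  rw [abs_mul, abs_mul]
  gcongr
  · exact hC t ht
  · exact hC _ (by linarith)

/-- A measurable function bounded on an interval is interval integrable there. -/
lemma intervalIntegrable_of_bound {f : ℝ → ℝ} (hf : Measurable f) {u v C : ℝ}
    (hC : ∀ t ∈ uIcc u v, |f t| ≤ C) : IntervalIntegrable f volume u v := by
  rw [intervalIntegrable_iff]
  refine Measure.integrableOn_of_bounded (M := C) (by simp) hf.aestronglyMeasurable ?_
  filter_upwards [ae_restrict_mem measurableSet_uIoc] with t ht
  exact hC t (uIoc_subset_uIcc ht)

lemma intervalIntegrable_kernel (hτ : 0 < τ) (u v : ℝ) :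
    IntervalIntegrable (kernel a b τ) volume u v := by
  obtain ⟨C, _, hC⟩ := exists_kernel_bound a b hτ (max u v)
  exact intervalIntegrable_of_bound (measurable_kernel hτ) fun t ht => hC t ht.2

/-- The delay equation of the fundamental solution in integral form. -/
lemma integral_kernel (hτ : 0 < τ) {t : ℝ} (ht : 0 ≤ t) :
    ∫ s in (0 : ℝ)..t, kernel a b τ s = X a b τ t - 1 := by
  -- Continuity of `X` makes the corner at `τ` harmless for the fundamental theorem of calculus.
  rw [integral_eq_of_hasDerivAt_off_countable_of_le (X a b τ) (kernel a b τ) ht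
    (s := {τ}) (countable_singleton τ) ((continuousOn_X hτ).mono Icc_subset_Ici_self) ?_
    (intervalIntegrable_kernel hτ 0 t), X_zero]
  rintro s ⟨hs, hsτ⟩
  exact hasDerivAt_X hτ hs.1.ne' hsτ

/-- The fundamental theorem of calculus for `X²`. Multiplied by `σ²`, it becomes the variance
equation; the constant `1` produces the term `σ²` there. -/
lemma integral_X_mul_kernel (hτ : 0 < τ) {t : ℝ} (ht : 0 ≤ t) :
    ∫ s in (0 : ℝ)..t, 2 * X a b τ s * kernel a b τ s = X a b τ t ^ 2 - 1 := by
  have hi : IntervalIntegrable (fun s => 2 * X a b τ s * kernel a b τ s) volume 0 t := by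
    obtain ⟨C, h0, hC⟩ := exists_kernel_bound a b hτ (max 0 t)
    obtain ⟨D, hD0, hD⟩ := exists_X_bound a b hτ (max 0 t)
    refine intervalIntegrable_of_bound (C := 2 * D * C)
      (((measurable_X hτ).const_mul 2).mul (measurable_kernel hτ)) fun s hs => ?_
    rw [Pi.mul_apply, abs_mul, abs_mul, abs_two]
    gcongr
    · exact hD s hs.2
    · exact hC s hs.2
  rw [integral_eq_of_hasDerivAt_off_countable_of_le (fun s => X a b τ s ^ 2)
    (fun s => 2 * X a b τ s * kernel a b τ s) ht
    (s := {τ}) (countable_singleton τ)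
    (((continuousOn_X hτ).mono Icc_subset_Ici_self).pow 2) ?_ hi, X_zero, one_pow]
  rintro s ⟨hs, hsτ⟩
  exact ((hasDerivAt_X hτ hs.1.ne' hsτ).fun_pow 2).congr_deriv (by simp [kernel])

end FundamentalSolution

/-! ### Forced delay equation: convolution with the fundamental solution -/

section Duhamel

variable {a b τ : ℝ} {g : ℝ → ℝ}

/-- The solution of the delay equation with forcing term `g` and zero initial data. -/
noncomputable def duhamel (a b τ : ℝ) (g : ℝ → ℝ) (t : ℝ) : ℝ :=
  ∫ u in (0 : ℝ)..t, X a b τ (t - u) * g u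

lemma intervalIntegrable_comp_sub_mul {f : ℝ → ℝ} (hf : Measurable f)
    (hb : ∀ T, ∃ C, 0 ≤ C ∧ ∀ t ≤ T, |f t| ≤ C) {u v : ℝ} (hg : IntervalIntegrable g volume u v)
    (s : ℝ) : IntervalIntegrable (fun x => f (s - x) * g x) volume u v := by
  obtain ⟨C, _, hC⟩ := hb (s - min u v)
  rw [intervalIntegrable_iff] at hg ⊢
  refine Integrable.bdd_mul (c := C) hg (hf.comp (measurable_id.const_sub s)).aestronglyMeasurable ?_
  filter_upwards [ae_restrict_mem measurableSet_uIoc] with x hx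
  exact hC _ (by linarith [hx.1])

lemma intervalIntegrable_X_mul (hτ : 0 < τ) {u v : ℝ} (hg : IntervalIntegrable g volume u v)
    (s : ℝ) : IntervalIntegrable (fun x => X a b τ (s - x) * g x) volume u v :=
  intervalIntegrable_comp_sub_mul (measurable_X hτ) (exists_X_bound a b hτ) hg s

/-- A causal convolution does not see the forcing term after time `s`. -/
lemma integral_comp_sub_mul_extend {f : ℝ → ℝ} (hf : Measurable f)
    (hb : ∀ T, ∃ C, 0 ≤ C ∧ ∀ t ≤ T, |f t| ≤ C) (h0 : ∀ t < 0, f t = 0) {s t : ℝ}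
    (hs : 0 ≤ s) (hst : s ≤ t) (hg : IntervalIntegrable g volume 0 t) :
    ∫ u in (0 : ℝ)..t, f (s - u) * g u = ∫ u in (0 : ℝ)..s, f (s - u) * g u := by
  have h1 : IntervalIntegrable g volume 0 s :=
    hg.mono_set (by rw [uIcc_of_le hs, uIcc_of_le (hs.trans hst)]; exact Icc_subset_Icc_right hst)
  have h2 : IntervalIntegrable g volume s t :=
    hg.mono_set (by rw [uIcc_of_le hst, uIcc_of_le (hs.trans hst)]; exact Icc_subset_Icc_left hs)
  rw [← intervalIntegral.integral_add_adjacent_intervals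
    (intervalIntegrable_comp_sub_mul hf hb h1 s) (intervalIntegrable_comp_sub_mul hf hb h2 s),
    add_eq_left]
  refine intervalIntegral.integral_zero_ae (Eventually.of_forall fun u hu => ?_)
  rw [uIoc_of_le hst] at hu
  rw [h0 _ (by linarith [hu.1]), zero_mul]

lemma duhamel_of_nonpos {t : ℝ} (ht : t ≤ 0) : duhamel a b τ g t = 0 := by
  refine intervalIntegral.integral_zero_ae (Eventually.of_forall fun u hu => ?_)
  rw [uIoc_of_ge ht] at hu
  rw [X_of_neg (by linarith [hu.1]), zero_mul]

/-- The kernel is split into its two summands. The delayed one contributes only up to time `s - τ`,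
because `X` vanishes at negative arguments. -/
lemma integral_kernel_mul_eq (hτ : 0 < τ) {s : ℝ} (hs : 0 ≤ s)
    (hg : IntervalIntegrable g volume 0 s) :
    ∫ u in (0 : ℝ)..s, kernel a b τ (s - u) * g u =
      a * duhamel a b τ g s + b * duhamel a b τ g (s - τ) := by
  have h1 := intervalIntegrable_X_mul (a := a) (b := b) hτ hg s
  have h2 := intervalIntegrable_X_mul (a := a) (b := b) hτ hg (s - τ)
  have h3 : ∫ u in (0 : ℝ)..s, X a b τ (s - τ - u) * g u = duhamel a b τ g (s - τ) := by
    rcases le_total 0 (s - τ) with h | h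
    · exact integral_comp_sub_mul_extend (measurable_X hτ) (exists_X_bound a b hτ)
        (fun t ht => X_of_neg ht) h (by linarith) hg
    · rw [duhamel_of_nonpos h]
      refine intervalIntegral.integral_zero_ae (Eventually.of_forall fun u hu => ?_)
      rw [uIoc_of_le hs] at hu
      rw [X_of_neg (by linarith [hu.1]), zero_mul]
  rw [duhamel, ← h3, ← intervalIntegral.integral_const_mul, ← intervalIntegral.integral_const_mul,
    ← intervalIntegral.integral_add (h1.const_mul a) (h2.const_mul b)]
  refine intervalIntegral.integral_congr fun u _ => ?_
  simp only [kernel, show s - u - τ = s - τ - u by ring]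
  ring

lemma integrable_kernel_mul_prod (hτ : 0 < τ) {t : ℝ} (ht : 0 ≤ t)
    (hg : IntervalIntegrable g volume 0 t) :
    Integrable (Function.uncurry fun s u => kernel a b τ (s - u) * g u)
      ((volume.restrict (uIoc 0 t)).prod (volume.restrict (uIoc 0 t))) := by
  obtain ⟨C, _, hC⟩ := exists_kernel_bound a b hτ t
  rw [intervalIntegrable_iff] at hg
  have : IsFiniteMeasure (volume.restrict (uIoc 0 t)) := by
    rw [uIoc_of_le ht]; infer_instance
  have hg2 : Integrable (fun z : ℝ × ℝ => g z.2)
      ((volume.restrict (uIoc 0 t)).prod (volume.restrict (uIoc 0 t))) :=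
    Integrable.comp_snd hg _
  refine Integrable.bdd_mul (c := C) hg2
    ((measurable_kernel hτ).comp (measurable_fst.sub measurable_snd)).aestronglyMeasurable ?_
  rw [Measure.prod_restrict]
  filter_upwards [ae_restrict_mem (measurableSet_uIoc.prod measurableSet_uIoc)] with z hz
  rw [uIoc_of_le ht] at hz
  exact hC _ (by linarith [hz.1.2, hz.2.1])

/-- The equation satisfied by `duhamel g`, in integral form. -/
lemma duhamel_eq_integral (hτ : 0 < τ) {t : ℝ} (ht : 0 ≤ t)
    (hg : IntervalIntegrable g volume 0 t) :
    IntervalIntegrable (fun s => a * duhamel a b τ g s + b * duhamel a b τ g (s - τ)) volume 0 t ∧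
    duhamel a b τ g t =
      ∫ s in (0 : ℝ)..t, (g s + (a * duhamel a b τ g s + b * duhamel a b τ g (s - τ))) := by
  have hsub : ∀ s ∈ uIoc 0 t, IntervalIntegrable g volume 0 s := fun s hs => by
    rw [uIoc_of_le ht] at hs
    exact hg.mono_set
      (by rw [uIcc_of_le hs.1.le, uIcc_of_le ht]; exact Icc_subset_Icc_right hs.2)
  have hF : ∀ s ∈ uIoc 0 t, ∫ u in (0 : ℝ)..t, kernel a b τ (s - u) * g u =
      a * duhamel a b τ g s + b * duhamel a b τ g (s - τ) := fun s hs => by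
    have hs' := hs
    rw [uIoc_of_le ht] at hs'
    rw [← integral_kernel_mul_eq hτ hs'.1.le (hsub s hs)]
    exact integral_comp_sub_mul_extend (measurable_kernel hτ) (exists_kernel_bound a b hτ)
      (fun t ht => kernel_of_neg hτ ht) hs'.1.le hs'.2 hg
  have hint := integrable_kernel_mul_prod (a := a) (b := b) hτ ht hg
  have hI : IntervalIntegrable
      (fun s => a * duhamel a b τ g s + b * duhamel a b τ g (s - τ)) volume 0 t := by
    rw [intervalIntegrable_iff]
    refine (hint.integral_prod_left).congr ?_
    filter_upwards [ae_restrict_mem measurableSet_uIoc] with s hs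
    rw [← hF s hs, intervalIntegral.integral_of_le ht, uIoc_of_le ht]
    rfl
  refine ⟨hI, ?_⟩
  -- By Fubini, for fixed `u` the kernel integrates in `s` to `X(t - u) - 1`. The `-1`, due to the
  -- jump of `X` at `0`, is cancelled by the forcing term `g`.
  have hsw : ∫ s in (0 : ℝ)..t, (a * duhamel a b τ g s + b * duhamel a b τ g (s - τ)) =
      ∫ u in (0 : ℝ)..t, (X a b τ (t - u) - 1) * g u := by
    rw [← intervalIntegral.integral_congr_ae
      (f := fun s => ∫ u in (0 : ℝ)..t, kernel a b τ (s - u) * g u)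
      (Eventually.of_forall hF), intervalIntegral_intervalIntegral_swap]
    · refine intervalIntegral.integral_congr_ae (Eventually.of_forall fun u hu => ?_)
      rw [uIoc_of_le ht] at hu
      rw [intervalIntegral.integral_mul_const]
      congr 1
      have hk : ∀ p q : ℝ, IntervalIntegrable (fun s => kernel a b τ (s - u)) volume p q :=
        fun p q => by
          simpa using (intervalIntegrable_kernel (a := a) (b := b) hτ (p - u) (q - u)).comp_sub_right u
      rw [← intervalIntegral.integral_add_adjacent_intervals (hk 0 u) (hk u t)]
      rw [intervalIntegral.integral_comp_sub_right (fun s => kernel a b τ s) u (a := u) (b := t),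
        sub_self, integral_kernel hτ (by linarith [hu.2]), add_eq_right]
      -- The endpoint `s = u` must be discarded: the kernel takes the value `a` at `0`.
      refine intervalIntegral.integral_zero_ae ?_
      filter_upwards [compl_mem_ae_iff.2 (measure_singleton u)] with s hsu hs
      rw [uIoc_of_le hu.1.le] at hs
      have hsu' : s ≠ u := hsu
      exact kernel_of_neg hτ (sub_neg.2 (lt_of_le_of_ne hs.2 hsu'))
    · rw [Measure.prod_restrict] at hint
      exact hint
  rw [intervalIntegral.integral_add hg hI, hsw, ← intervalIntegral.integral_add hg]
  · exact intervalIntegral.integral_congr fun u _ => by ring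
  · simpa [sub_mul] using (intervalIntegrable_X_mul (a := a) (b := b) hτ hg t).sub hg

lemma continuous_duhamel (hτ : 0 < τ) (hg : ∀ t, 0 ≤ t → IntervalIntegrable g volume 0 t) :
    Continuous (duhamel a b τ g) := by
  have hcont : ∀ T, 0 ≤ T → ContinuousOn (duhamel a b τ g) (Icc 0 T) := fun T hT => by
    have hI := (hg T hT).add (duhamel_eq_integral (a := a) (b := b) hτ hT (hg T hT)).1
    have h := intervalIntegral.continuousOn_primitive_interval' hI left_mem_uIcc
    rw [uIcc_of_le hT] at h
    exact h.congr fun t ht => (duhamel_eq_integral hτ ht.1 (hg t ht.1)).2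
  have hIci : ContinuousOn (duhamel a b τ g) (Ici 0) := by
    intro t ht
    refine ((hcont (t + 1) (by linarith [mem_Ici.1 ht])) t ⟨ht, by linarith⟩).mono_of_mem_nhdsWithin ?_
    filter_upwards [self_mem_nhdsWithin,
      mem_nhdsWithin_of_mem_nhds (Iio_mem_nhds (show t < t + 1 by linarith))] with s h1 h2
      using ⟨h1, le_of_lt h2⟩
  have : duhamel a b τ g = fun t => duhamel a b τ g (max t 0) := by
    ext t
    rcases le_total t 0 with h | h
    · rw [max_eq_right h, duhamel_of_nonpos h, duhamel_of_nonpos le_rfl]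
    · rw [max_eq_left h]
  rw [this]
  exact hIci.comp_continuous (by fun_prop) fun t => mem_Ici.2 (le_max_right _ _)

end Duhamel

/-! ### Regularity, uniqueness and the noiseless solution -/

section DelayEquation

variable {a b τ : ℝ}

/-- A continuous solution of the delay equation in integral form is differentiable. -/
lemma hasDerivAt_of_eq_integral {z : ℝ → ℝ} {c : ℝ} (hz : ContinuousOn z (Ici (-τ))) (hτ : 0 < τ)
    (heq : ∀ t, 0 ≤ t → z t = c + ∫ s in (0 : ℝ)..t, (a * z s + b * z (s - τ))) {t : ℝ} :
    (0 < t → HasDerivAt z (a * z t + b * z (t - τ)) t) ∧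
      (0 ≤ t → HasDerivWithinAt z (a * z t + b * z (t - τ)) (Ici t) t) := by
  -- Clamping the arguments gives an integrand continuous on the whole line that agrees with the
  -- original one for `s ≥ 0`.
  set h : ℝ → ℝ := fun s => a * z (max s 0) + b * z (max (s - τ) (-τ)) with hh
  have hc : Continuous h := by
    refine (Continuous.const_mul ?_ a).add (Continuous.const_mul ?_ b)
    · exact hz.comp_continuous (by fun_prop) fun s => mem_Ici.2
        ((by linarith : -τ ≤ 0).trans (le_max_right _ _))
    · exact hz.comp_continuous (by fun_prop) fun s => mem_Ici.2 (le_max_right _ _)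
  have hhs : ∀ s, 0 ≤ s → h s = a * z s + b * z (s - τ) := fun s hs => by
    simp only [hh, max_eq_left hs, max_eq_left (show -τ ≤ s - τ by linarith)]
  have hzF : ∀ s, 0 ≤ s → z s = c + ∫ q in (0 : ℝ)..s, h q := fun s hs => by
    rw [heq s hs]
    congr 1
    refine intervalIntegral.integral_congr fun q hq => ?_
    rw [uIcc_of_le hs] at hq
    exact (hhs q hq.1).symm
  have hd : ∀ s, HasDerivAt (fun s => c + ∫ q in (0 : ℝ)..s, h q) (h s) s := fun s =>
    (intervalIntegral.integral_hasDerivAt_right (hc.intervalIntegrable _ _)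
      (hc.stronglyMeasurableAtFilter _ _) hc.continuousAt).const_add c
  constructor
  · intro ht
    rw [← hhs t ht.le]
    refine (hd t).congr_of_eventuallyEq ?_
    filter_upwards [Ioi_mem_nhds ht] with s hs using hzF s (le_of_lt hs)
  · intro ht
    rw [← hhs t ht]
    exact (hd t).hasDerivWithinAt.congr (fun s hs => hzF s (ht.trans hs)) (hzF t ht)

/-- Uniqueness for the delay equation in integral form. -/
lemma eq_zero_of_eq_integral {z : ℝ → ℝ} (hτ : 0 < τ) (hz : ContinuousOn z (Ici (-τ)))
    (h0 : ∀ t ∈ Icc (-τ) 0, z t = 0)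
    (heq : ∀ t, 0 ≤ t → z t = ∫ s in (0 : ℝ)..t, (a * z s + b * z (s - τ))) {t : ℝ}
    (ht : -τ ≤ t) : z t = 0 := by
  -- Method of steps: up to time `(n + 1) τ` the delayed value is zero by induction, which leaves
  -- `|z'| ≤ |a| |z|` for Gronwall.
  have key : ∀ n : ℕ, ∀ t ∈ Icc (-τ) (n * τ), z t = 0 := by
    intro n
    induction n with
    | zero => simpa using h0
    | succ n ih =>
      intro t ht
      rcases le_total t 0 with h | h
      · exact h0 t ⟨ht.1, h⟩
      have hT := ht.2
      push_cast at hT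
      have := norm_le_gronwallBound_of_norm_deriv_right_le (f := z)
        (f' := fun s => a * z s + b * z (s - τ)) (δ := 0) (K := |a|) (ε := 0) (a := 0)
        (b := (n + 1) * τ) (hz.mono (fun s hs => by simp only [mem_Ici]; linarith [hs.1]))
        (fun s hs => (hasDerivAt_of_eq_integral (c := 0) hz hτ (by simpa using heq)).2 hs.1)
        (by simp [h0 0 ⟨by linarith, le_rfl⟩])
        (fun s hs => by
          rw [ih (s - τ) ⟨by linarith [hs.1], by linarith [hs.2]⟩]
          simp) t ⟨h, hT⟩
      simpa [gronwallBound_ε0_δ0] using this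
  obtain ⟨n, hn⟩ := exists_nat_gt (t / τ)
  exact key n t ⟨ht, ((div_lt_iff₀ hτ).1 hn).le⟩

variable {φ : ℝ → ℝ}

/-- The forcing term which represents the initial function. -/
noncomputable def initialForcing (b τ : ℝ) (φ : ℝ → ℝ) (u : ℝ) : ℝ :=
  if u < τ then b * φ (u - τ) else 0

lemma intervalIntegrable_initialForcing (hτ : 0 < τ) (hφ : ContinuousOn φ (Icc (-τ) 0)) {t : ℝ}
    (ht : 0 ≤ t) : IntervalIntegrable (initialForcing b τ φ) volume 0 t := by
  set ψ : ℝ → ℝ := IccExtend (show -τ ≤ 0 by linarith) ((Icc (-τ) 0).domRestrict φ) with hψ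
  have hψc : Continuous ψ := hφ.domRestrict.Icc_extend'
  have : IntervalIntegrable ((Iio τ).indicator fun u => b * ψ (u - τ)) volume 0 t := by
    rw [intervalIntegrable_iff]
    refine Integrable.indicator ?_ measurableSet_Iio
    rw [← IntegrableOn, ← intervalIntegrable_iff]
    exact Continuous.intervalIntegrable (by fun_prop) _ _
  refine this.congr fun u hu => ?_
  rw [uIoc_of_le ht] at hu
  by_cases h : u < τ
  · rw [indicator_of_mem (show u ∈ Iio τ from h), initialForcing, if_pos h, hψ,
      IccExtend_of_mem _ _ (show u - τ ∈ Icc (-τ) 0 from ⟨by linarith [hu.1], by linarith⟩)]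
    rfl
  · rw [indicator_of_notMem (show u ∉ Iio τ from h), initialForcing, if_neg h]

lemma S_of_neg {t : ℝ} (ht : t < 0) : S a b τ φ t = φ t := if_pos ht

/-- The substitution `u = q + τ` turns the initial segment into a forcing on `[0, τ)`. The interval
`[0, τ]` may be replaced by `[0, t]`: for `t ≤ τ` by causality, for `t ≥ τ` because the forcing has
ended. -/
lemma S_of_nonneg (hτ : 0 < τ) (hφ : ContinuousOn φ (Icc (-τ) 0)) {t : ℝ} (ht : 0 ≤ t) :
    S a b τ φ t = X a b τ t * φ 0 + duhamel a b τ (initialForcing b τ φ) t := by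
  have hg : ∀ t, 0 ≤ t → IntervalIntegrable (initialForcing b τ φ) volume 0 t :=
    fun t ht => intervalIntegrable_initialForcing hτ hφ ht
  rw [S, if_neg ht.not_gt]
  congr 1
  have h1 : b * ∫ q in (-τ)..0, X a b τ (t - q - τ) * φ q =
      ∫ u in (0 : ℝ)..τ, X a b τ (t - u) * initialForcing b τ φ u := by
    have := intervalIntegral.integral_comp_sub_right
      (fun q => X a b τ (t - q - τ) * φ q) τ (a := 0) (b := τ)
    rw [zero_sub, sub_self] at this
    rw [← this, ← intervalIntegral.integral_const_mul]
    refine intervalIntegral.integral_congr_ae ?_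
    filter_upwards [compl_mem_ae_iff.2 (measure_singleton τ)] with u hu hu'
    rw [uIoc_of_le hτ.le] at hu'
    rw [initialForcing, if_pos (lt_of_le_of_ne hu'.2 hu), show t - (u - τ) - τ = t - u by ring]
    ring
  rw [h1, duhamel]
  rcases le_total t τ with h | h
  · exact integral_comp_sub_mul_extend (measurable_X hτ) (exists_X_bound a b hτ)
      (fun t ht' => X_of_neg ht') ht h (hg τ hτ.le)
  · rw [← intervalIntegral.integral_add_adjacent_intervals (b := τ) (c := t)
      (intervalIntegrable_X_mul hτ (hg τ hτ.le) t)
      (intervalIntegrable_X_mul hτ (((hg τ hτ.le).symm).trans (hg t ht)) t), eq_comm, add_eq_left]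
    refine intervalIntegral.integral_zero_ae (Eventually.of_forall fun u hu => ?_)
    rw [uIoc_of_le h] at hu
    rw [initialForcing, if_neg hu.1.le.not_gt, mul_zero]

lemma S_zero (hτ : 0 < τ) (hφ : ContinuousOn φ (Icc (-τ) 0)) : S a b τ φ 0 = φ 0 := by
  rw [S_of_nonneg hτ hφ le_rfl, X_zero, duhamel_of_nonpos le_rfl, one_mul, add_zero]

lemma S_eq_initial (hτ : 0 < τ) (hφ : ContinuousOn φ (Icc (-τ) 0)) {t : ℝ} (ht : t ∈ Icc (-τ) 0) :
    S a b τ φ t = φ t := by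
  rcases ht.2.lt_or_eq with h | rfl
  · exact S_of_neg h
  · exact S_zero hτ hφ

lemma continuousOn_S (hτ : 0 < τ) (hφ : ContinuousOn φ (Icc (-τ) 0)) :
    ContinuousOn (S a b τ φ) (Ici (-τ)) := by
  rw [← Icc_union_Ici_eq_Ici (show -τ ≤ 0 by linarith)]
  refine ContinuousOn.union_of_isClosed ?_ ?_ isClosed_Icc isClosed_Ici
  · exact hφ.congr fun t ht => S_eq_initial hτ hφ ht
  · refine ContinuousOn.congr (((continuousOn_X hτ).mul continuousOn_const).add
      (continuous_duhamel hτ fun t ht => intervalIntegrable_initialForcing hτ hφ ht).continuousOn)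
      fun t ht => S_of_nonneg hτ hφ ht

lemma S_eq_integral (hτ : 0 < τ) (hφ : ContinuousOn φ (Icc (-τ) 0)) {t : ℝ} (ht : 0 ≤ t) :
    S a b τ φ t = φ 0 + ∫ s in (0 : ℝ)..t, (a * S a b τ φ s + b * S a b τ φ (s - τ)) := by
  have hg := intervalIntegrable_initialForcing (b := b) hτ hφ ht
  obtain ⟨hI, hD⟩ := duhamel_eq_integral (a := a) (b := b) hτ ht hg
  have hX := integral_kernel (a := a) (b := b) hτ ht
  have hk := intervalIntegrable_kernel (a := a) (b := b) hτ 0 t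
  have hsum : ∫ s in (0 : ℝ)..t, (a * S a b τ φ s + b * S a b τ φ (s - τ)) =
      ∫ s in (0 : ℝ)..t, (kernel a b τ s * φ 0 + (initialForcing b τ φ s +
        (a * duhamel a b τ (initialForcing b τ φ) s
          + b * duhamel a b τ (initialForcing b τ φ) (s - τ)))) := by
    refine intervalIntegral.integral_congr fun s hs => ?_
    rw [uIcc_of_le ht] at hs
    rw [S_of_nonneg hτ hφ hs.1, kernel]
    -- Before `τ` the delayed value is `φ` and is supplied by the forcing; from `τ` on it is given
    -- by the representation of `S` itself.
    rcases lt_or_ge s τ with h | h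
    · rw [S_of_neg (by linarith), initialForcing, if_pos h, X_of_neg (sub_neg.2 h),
        duhamel_of_nonpos (t := s - τ) (by linarith)]
      ring
    · rw [S_of_nonneg hτ hφ (sub_nonneg.2 h), initialForcing, if_neg h.not_gt]
      ring
  rw [hsum, intervalIntegral.integral_add (hk.mul_const _) (hg.add hI), ← hD,
    intervalIntegral.integral_mul_const, hX, S_of_nonneg hτ hφ ht]
  ring

lemma hasDerivAt_S (hτ : 0 < τ) (hφ : ContinuousOn φ (Icc (-τ) 0)) {t : ℝ} (ht : 0 < t) :
    HasDerivAt (S a b τ φ) (a * S a b τ φ t + b * S a b τ φ (t - τ)) t :=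
  (hasDerivAt_of_eq_integral (continuousOn_S hτ hφ) hτ fun _ hs => S_eq_integral hτ hφ hs).1 ht

end DelayEquation

/-! ### Pathwise response to the noise -/

section Noise

variable {a b τ : ℝ} {W : ℝ → ℝ}

/-- The response of the delay equation to the noise path `W`. -/
noncomputable def noise (a b τ : ℝ) (W : ℝ → ℝ) (t : ℝ) : ℝ :=
  W t + (a * duhamel a b τ W t + b * duhamel a b τ W (t - τ))

lemma noise_eq_add_integral (hτ : 0 < τ) (hW : Continuous W) {t : ℝ} (ht : 0 ≤ t) :
    noise a b τ W t = W t + ∫ u in (0 : ℝ)..t, kernel a b τ (t - u) * W u := by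
  rw [noise, integral_kernel_mul_eq hτ ht (hW.intervalIntegrable _ _)]

lemma noise_of_nonpos (hτ : 0 < τ) (hW0 : ∀ t ≤ 0, W t = 0) {t : ℝ} (ht : t ≤ 0) :
    noise a b τ W t = 0 := by
  rw [noise, hW0 t ht, duhamel_of_nonpos ht, duhamel_of_nonpos (by linarith)]
  simp

lemma continuous_noise (hτ : 0 < τ) (hW : Continuous W) : Continuous (noise a b τ W) := by
  have := continuous_duhamel (a := a) (b := b) hτ fun t _ => hW.intervalIntegrable 0 t
  unfold noise
  fun_prop

lemma integral_noise (hτ : 0 < τ) (hW : Continuous W) {t : ℝ} (ht : 0 ≤ t) :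
    ∫ s in (0 : ℝ)..t, noise a b τ W s = duhamel a b τ W t :=
  (duhamel_eq_integral hτ ht (hW.intervalIntegrable _ _)).2.symm

/-- `duhamel` of `W` is a primitive of the noise, so the definition of `noise` is already this
equation once the delayed integral is shifted by `τ`; negative times contribute nothing. -/
lemma noise_eq_integral (hτ : 0 < τ) (hW : Continuous W) (hW0 : ∀ t ≤ 0, W t = 0) (t : ℝ) :
    noise a b τ W t =
      (∫ s in (0 : ℝ)..t, (a * noise a b τ W s + b * noise a b τ W (s - τ))) + W t := by
  have hc := continuous_noise (a := a) (b := b) hτ hW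
  have hneg : ∀ p q : ℝ, p ≤ 0 → q ≤ 0 → ∫ s in p..q, noise a b τ W s = 0 := fun p q hp hq => by
    refine intervalIntegral.integral_zero_ae (Eventually.of_forall fun s hs => ?_)
    exact noise_of_nonpos hτ hW0 (hs.2.trans (max_le hp hq))
  have hall : ∀ q, ∫ s in (0 : ℝ)..q, noise a b τ W s = duhamel a b τ W q := fun q => by
    rcases le_total 0 q with h | h
    · exact integral_noise hτ hW h
    · rw [hneg 0 q le_rfl h, duhamel_of_nonpos h]
  rw [intervalIntegral.integral_add (Continuous.intervalIntegrable (by fun_prop) _ _)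
    (Continuous.intervalIntegrable (by fun_prop) _ _), intervalIntegral.integral_const_mul,
    intervalIntegral.integral_const_mul, hall,
    intervalIntegral.integral_comp_sub_right (fun s => noise a b τ W s), zero_sub,
    ← intervalIntegral.integral_add_adjacent_intervals (b := 0)
      (hc.intervalIntegrable _ _) (hc.intervalIntegrable _ _), hneg _ _ (by linarith) le_rfl, hall,
    noise]
  ring

/-- Pathwise representation of the solution of the delay equation driven by the path `W`. -/
lemma eq_S_add_noise {σ : ℝ} {φ y : ℝ → ℝ} (hτ : 0 < τ) (hφ : ContinuousOn φ (Icc (-τ) 0))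
    (hW : Continuous W) (hW0 : ∀ t ≤ 0, W t = 0) (hy : ContinuousOn y (Ici (-τ)))
    (hy0 : ∀ t ∈ Icc (-τ) 0, y t = φ t)
    (heq : ∀ t, 0 ≤ t → y t = φ 0 + (∫ s in (0 : ℝ)..t, (a * y s + b * y (s - τ))) + σ * W t)
    {t : ℝ} (ht : -τ ≤ t) : y t = S a b τ φ t + σ * noise a b τ W t := by
  have hS := continuousOn_S (a := a) (b := b) hτ hφ
  have hN := continuous_noise (a := a) (b := b) hτ hW
  rw [← sub_eq_zero]
  have hII : ∀ f : ℝ → ℝ, ContinuousOn f (Ici (-τ)) → ∀ t, 0 ≤ t →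
      IntervalIntegrable (fun s => a * f s + b * f (s - τ)) volume 0 t := fun f hf t ht => by
    refine ContinuousOn.intervalIntegrable ?_
    rw [uIcc_of_le ht]
    refine (ContinuousOn.const_mul (hf.mono fun s hs => ?_) a).add
      (ContinuousOn.const_mul (hf.comp (by fun_prop) fun s hs => ?_) b)
    · simp only [mem_Ici]; linarith [hs.1]
    · simp only [mem_Ici]; linarith [hs.1]
  -- In the difference both the initial data and `W` cancel, so it solves the homogeneous equation.
  refine eq_zero_of_eq_integral (a := a) (b := b)
    (z := fun t => y t - (S a b τ φ t + σ * noise a b τ W t)) hτ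
    (hy.sub (hS.add (hN.const_mul σ).continuousOn)) (fun s hs => ?_) (fun s hs => ?_) ht
  · rw [hy0 s hs, S_eq_initial hτ hφ hs, noise_of_nonpos hτ hW0 hs.2]
    ring
  · rw [heq s hs, S_eq_integral hτ hφ hs, noise_eq_integral hτ hW hW0]
    have e : ∫ q in (0 : ℝ)..s, (a * (y q - (S a b τ φ q + σ * noise a b τ W q))
        + b * (y (q - τ) - (S a b τ φ (q - τ) + σ * noise a b τ W (q - τ)))) =
        ∫ q in (0 : ℝ)..s, ((a * y q + b * y (q - τ)) - (a * S a b τ φ q + b * S a b τ φ (q - τ))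
          - σ * (a * noise a b τ W q + b * noise a b τ W (q - τ))) :=
      intervalIntegral.integral_congr fun q _ => by ring
    rw [e, intervalIntegral.integral_sub ((hII y hy s hs).sub (hII _ hS s hs))
      ((hII _ hN.continuousOn s hs).const_mul σ),
      intervalIntegral.integral_sub (hII y hy s hs) (hII _ hS s hs),
      intervalIntegral.integral_const_mul]
    ring

end Noise

/-! ### Riemann sums -/

section RiemannSum

/-- Convergence of weighted Riemann sums along the uniform partitions of `[0, t]`. -/
lemma tendsto_weighted_riemann_sum {g f : ℝ → ℝ} {t M : ℝ} (ht : 0 < t)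
    (hg : IntervalIntegrable g volume 0 t) (hM : ∀ s ∈ Icc 0 t, |f s| ≤ M)
    (hf : ∀ᵐ u, u ∈ uIoc 0 t → ContinuousAt f u) :
    Tendsto (fun n : ℕ => ∑ i ∈ Finset.range (n + 1),
      (∫ u in (i : ℝ) * (t / (n + 1 : ℕ))..(i + 1 : ℕ) * (t / (n + 1 : ℕ)), g u)
        * f (i * (t / (n + 1 : ℕ)))) atTop (𝓝 (∫ u in (0 : ℝ)..t, g u * f u)) := by
  -- `ρ n u` is the left endpoint of the cell containing `u`. The sum is then a single integral of
  -- `g u * f (ρ n u)`, ready for dominated convergence.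
  set ρ : ℕ → ℝ → ℝ := fun n u => (⌊u / t * (n + 1 : ℕ)⌋₊ : ℝ) * (t / (n + 1 : ℕ)) with hρ
  have hρ_meas : ∀ n, Measurable fun u => f (ρ n u) := fun n =>
    (measurable_from_top (f := fun k : ℕ => f (k * (t / (n + 1 : ℕ))))).comp
      (Nat.measurable_floor.comp (by fun_prop : Measurable fun u : ℝ => u / t * (n + 1 : ℕ)))
  have hρ_mem : ∀ n, ∀ u ∈ Ioc 0 t, ρ n u ∈ Icc 0 t := fun n u hu => by
    have h1 : (⌊u / t * (n + 1 : ℕ)⌋₊ : ℝ) ≤ u / t * (n + 1 : ℕ) :=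
      Nat.floor_le (by have := hu.1.le; positivity)
    refine ⟨by positivity, (mul_le_mul_of_nonneg_right h1 (by positivity)).trans ?_⟩
    have hn : ((n + 1 : ℕ) : ℝ) ≠ 0 := by positivity
    rw [show u / t * (n + 1 : ℕ) * (t / (n + 1 : ℕ)) = u by field_simp]
    exact hu.2
  have hbd : ∀ n, ∀ u ∈ Ioc 0 t, ‖g u * f (ρ n u)‖ ≤ |g u| * M := fun n u hu => by
    rw [norm_mul, Real.norm_eq_abs, Real.norm_eq_abs]
    exact mul_le_mul_of_nonneg_left (hM _ (hρ_mem n u hu)) (abs_nonneg _)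
  have hgm := (intervalIntegrable_iff.1 hg).aestronglyMeasurable
  have hint : ∀ n, IntervalIntegrable (fun u => g u * f (ρ n u)) volume 0 t := fun n => by
    refine (hg.abs.mul_const M).mono_fun' (hgm.mul (hρ_meas n).aestronglyMeasurable) ?_
    filter_upwards [ae_restrict_mem measurableSet_uIoc] with u hu
    rw [uIoc_of_le ht.le] at hu
    exact hbd n u hu
  have hsum : ∀ n : ℕ, ∑ i ∈ Finset.range (n + 1),
      (∫ u in (i : ℝ) * (t / (n + 1 : ℕ))..(i + 1 : ℕ) * (t / (n + 1 : ℕ)), g u)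
        * f (i * (t / (n + 1 : ℕ))) = ∫ u in (0 : ℝ)..t, g u * f (ρ n u) := fun n => by
    set d : ℝ := t / (n + 1 : ℕ) with hd
    have hd0 : 0 < d := by positivity
    have htd : ((n + 1 : ℕ) : ℝ) * d = t := by
      have hn : ((n + 1 : ℕ) : ℝ) ≠ 0 := by positivity
      rw [hd]; field_simp
    have hle : ∀ i : ℕ, (i : ℝ) * d ≤ (i + 1 : ℕ) * d := fun i => by push_cast; nlinarith
    have hadj := intervalIntegral.sum_integral_adjacent_intervals (n := n + 1) (μ := volume)
      (f := fun u => g u * f (ρ n u)) (a := fun i : ℕ => (i : ℝ) * d) fun i hi => by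
        refine (hint n).mono_set ?_
        rw [uIcc_of_le (hle i), uIcc_of_le ht.le]
        refine Icc_subset_Icc (by positivity) ?_
        rw [← htd]
        have : ((i + 1 : ℕ) : ℝ) ≤ (n + 1 : ℕ) := by exact_mod_cast hi
        exact mul_le_mul_of_nonneg_right this hd0.le
    rw [Nat.cast_zero, zero_mul, htd] at hadj
    rw [← hadj]
    refine Finset.sum_congr rfl fun i _ => ?_
    rw [← intervalIntegral.integral_mul_const]
    refine intervalIntegral.integral_congr_ae ?_
    filter_upwards [compl_mem_ae_iff.2 (measure_singleton (((i + 1 : ℕ) : ℝ) * d))] with u hu hu'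
    rw [uIoc_of_le (hle i)] at hu'
    have hlt : u < ((i + 1 : ℕ) : ℝ) * d := lt_of_le_of_ne hu'.2 hu
    have hu0 : u / t * (n + 1 : ℕ) = u / d := by
      have hn : ((n + 1 : ℕ) : ℝ) ≠ 0 := by positivity
      rw [hd]; field_simp
    have hfl : ⌊u / t * (n + 1 : ℕ)⌋₊ = i := by
      rw [hu0, Nat.floor_eq_iff (div_nonneg ((by positivity : (0 : ℝ) ≤ i * d).trans hu'.1.le) hd0.le),
        le_div_iff₀ hd0, div_lt_iff₀ hd0]
      exact ⟨hu'.1.le, by push_cast at hlt; exact hlt⟩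
    simp only [hρ, hfl]
    rfl
  simp_rw [hsum]
  refine intervalIntegral.tendsto_integral_filter_of_dominated_convergence (fun u => |g u| * M)
    (Eventually.of_forall fun n => hgm.mul (hρ_meas n).aestronglyMeasurable)
    (Eventually.of_forall fun n => Eventually.of_forall fun u hu => ?_) (hg.abs.mul_const M) ?_
  · rw [uIoc_of_le ht.le] at hu
    exact hbd n u hu
  · filter_upwards [hf] with u hu hmem
    refine Tendsto.const_mul _ ((hu hmem).tendsto.comp ?_)
    rw [uIoc_of_le ht.le] at hmem
    have h1 : Tendsto (fun n : ℕ => ((n + 1 : ℕ) : ℝ)) atTop atTop :=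
      tendsto_natCast_atTop_atTop.comp (tendsto_add_atTop_nat 1)
    have h2 := ((tendsto_nat_floor_mul_div_atTop (div_nonneg hmem.1.le ht.le)).comp h1).mul_const t
    rw [div_mul_cancel₀ _ ht.ne'] at h2
    refine h2.congr fun n => ?_
    simp only [hρ, Function.comp]
    ring

end RiemannSum

/-! ### Wiener integrals as limits of step-function integrals -/

section WienerLimit

variable {Ω : Type*} [MeasurableSpace Ω] {P : Measure Ω} {w : ℝ≥0 → Ω → ℝ}

/-- An almost sure limit of centred Gaussian variables with convergent variances is Gaussian. -/
lemma hasLaw_gaussianReal_of_tendsto [IsProbabilityMeasure P] {V : ℕ → Ω → ℝ} {U : Ω → ℝ}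
    {v : ℕ → ℝ≥0} {v₀ : ℝ≥0} (hV : ∀ n, HasLaw (V n) (gaussianReal 0 (v n)) P)
    (hlim : ∀ᵐ ω ∂P, Tendsto (fun n => V n ω) atTop (𝓝 (U ω))) (hv : Tendsto v atTop (𝓝 v₀)) :
    HasLaw U (gaussianReal 0 v₀) P := by
  have hU : AEMeasurable U P :=
    aemeasurable_of_tendsto_metrizable_ae atTop (fun n => (hV n).aemeasurable) hlim
  refine ⟨hU, ?_⟩
  have : IsProbabilityMeasure (P.map U) := Measure.isProbabilityMeasure_map hU
  -- The characteristic functions converge in two ways: by dominated convergence along the almost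
  -- sure limit, and by continuity of the Gaussian formula in the variance.
  refine Measure.ext_of_charFun ?_
  ext q
  have h1 : Tendsto (fun n => charFun (P.map (V n)) q) atTop (𝓝 (charFun (P.map U) q)) := by
    have e : ∀ Y : Ω → ℝ, AEMeasurable Y P →
        charFun (P.map Y) q = ∫ ω, Complex.exp (q * Y ω * Complex.I) ∂P := fun Y hY => by
      rw [charFun_apply_real, integral_map hY (by fun_prop)]
    simp_rw [e U hU, fun n => e (V n) (hV n).aemeasurable]
    refine tendsto_integral_of_dominated_convergence (fun _ => 1) (fun n => ?_)
      (integrable_const _) (fun n => Eventually.of_forall fun ω => ?_) ?_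
    · have hm := (hV n).aemeasurable
      refine (Complex.measurable_exp.comp_aemeasurable ?_).aestronglyMeasurable
      exact ((Complex.measurable_ofReal.comp_aemeasurable hm).const_mul _).mul_const _
    · rw [← Complex.ofReal_mul, Complex.norm_exp_ofReal_mul_I]
    · filter_upwards [hlim] with ω hω
      have : Continuous fun y : ℝ => Complex.exp (q * y * Complex.I) := by fun_prop
      exact (this.tendsto _).comp hω
  have h2 : Tendsto (fun n => charFun (P.map (V n)) q) atTop
      (𝓝 (charFun (gaussianReal 0 v₀) q)) := by
    simp_rw [fun n => (hV n).map_eq, charFun_gaussianReal]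
    have : Continuous fun y : ℝ≥0 =>
        Complex.exp (q * (0 : ℝ) * Complex.I - (y : ℝ) * q ^ 2 / 2) := by fun_prop
    exact (this.tendsto _).comp hv
  exact tendsto_nhds_unique h1 h2

/-- The indicator function of `[0, s)` at the time `v ≥ 0`, as a function of `s`. -/
noncomputable def ind (v : ℝ) (s : ℝ≥0) : ℝ := if v < s then 1 else 0

/-- The Brownian covariance `min s s'` is an `L²` inner product of indicators; hence the variance of
a linear combination of values of `w` is the squared norm of the corresponding step function. -/
lemma integral_ind_mul_ind (s s' : ℝ≥0) :
    IntegrableOn (fun v => ind v s * ind v s') (Ioi 0) ∧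
      ∫ v in Ioi 0, ind v s * ind v s' = min s s' := by
  have h : EqOn (fun v => ind v s * ind v s')
      ((Iio ((min s s' : ℝ≥0) : ℝ)).indicator fun _ => (1 : ℝ)) (Ioi 0) := fun v _ => by
    simp only [ind, indicator_apply, mem_Iio, NNReal.coe_min, lt_min_iff]
    split_ifs <;> simp_all
  constructor
  · rw [integrableOn_congr_fun h measurableSet_Ioi, integrableOn_indicator_iff measurableSet_Iio]
    rw [inter_comm, Ioi_inter_Iio]
    exact integrableOn_const (by simp)
  · rw [setIntegral_congr_fun measurableSet_Ioi h, setIntegral_indicator measurableSet_Iio,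
      Ioi_inter_Iio]
    simp

/-- The law of a finite linear combination of values of the Wiener process. -/
lemma hasLaw_linearCombination [IsProbabilityMeasure P] (hw : IsBrownianReal w P)
    (c : ℝ≥0 →₀ ℝ) :
    HasLaw (fun ω => Finsupp.linearCombination ℝ (fun s => w s ω) c)
      (gaussianReal 0 (∫ v in Ioi 0, Finsupp.linearCombination ℝ (ind v) c ^ 2).toNNReal) P := by
  have hmem : ∀ s, MemLp (w s) 2 P := fun s => (hw.isGaussianProcess.hasGaussianLaw_eval s).memLp_two
  have hG : HasGaussianLaw (fun ω => Finsupp.linearCombination ℝ (fun s => w s ω) c) P := by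
    simpa only [Finsupp.linearCombination_apply, Finsupp.sum] using
      (hw.isGaussianProcess.smul c).hasGaussianLaw_fun_sum (I := c.support)
  have hmean : P[fun ω => Finsupp.linearCombination ℝ (fun s => w s ω) c] = 0 := by
    simp only [Finsupp.linearCombination_apply, Finsupp.sum, smul_eq_mul]
    rw [integral_finsetSum _ fun s _ => (hw.integrable_eval s).const_mul _]
    refine Finset.sum_eq_zero fun s _ => ?_
    rw [integral_const_mul, hw.integral_eval, mul_zero]
  have hvar : Var[fun ω => Finsupp.linearCombination ℝ (fun s => w s ω) c; P] =
      ∫ v in Ioi 0, Finsupp.linearCombination ℝ (ind v) c ^ 2 := by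
    have e : ∀ v, Finsupp.linearCombination ℝ (ind v) c ^ 2 =
        ∑ s ∈ c.support, ∑ s' ∈ c.support, c s * c s' * (ind v s * ind v s') := fun v => by
      simp only [Finsupp.linearCombination_apply, Finsupp.sum, smul_eq_mul, sq, Finset.sum_mul_sum]
      exact Finset.sum_congr rfl fun s _ => Finset.sum_congr rfl fun s' _ => by ring
    simp_rw [e]
    rw [integral_finsetSum _ fun s _ => integrable_finsetSum _ fun s' _ =>
      (integral_ind_mul_ind s s').1.const_mul _]
    simp_rw [fun s => integral_finsetSum (μ := volume.restrict (Ioi 0)) c.support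
      (f := fun s' v => c s * c s' * (ind v s * ind v s')) fun s' _ =>
      (integral_ind_mul_ind s s').1.const_mul _, integral_const_mul,
      fun s s' => (integral_ind_mul_ind s s').2]
    rw [← covariance_self hG.aemeasurable]
    simp only [Finsupp.linearCombination_apply, Finsupp.sum, smul_eq_mul]
    rw [covariance_fun_sum_fun_sum' (fun s _ => (hmem s).const_mul _)
      (fun s _ => (hmem s).const_mul _)]
    refine Finset.sum_congr rfl fun s _ => Finset.sum_congr rfl fun s' _ => ?_
    rw [covariance_const_mul_left, covariance_const_mul_right, hw.covariance_fun_eval]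
    push_cast
    ring
  refine ⟨hG.aemeasurable, ?_⟩
  rw [hG.map_eq_gaussianReal, hmean, hvar]

/-- `U` is the almost sure limit of integrals of deterministic step functions with respect to the
Wiener process `w`, where the step functions are uniformly bounded with uniformly bounded supports
and converge almost everywhere to `h`. In particular `U` is the Wiener integral of `h`. -/
def IsWienerLimit (w : ℝ≥0 → Ω → ℝ) (P : Measure Ω) (h : ℝ → ℝ) (U : Ω → ℝ) : Prop :=
  ∃ c : ℕ → ℝ≥0 →₀ ℝ,
    (∀ᵐ ω ∂P, Tendsto (fun n => Finsupp.linearCombination ℝ (fun s => w s ω) (c n)) atTop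
      (𝓝 (U ω))) ∧
    (∃ C T : ℝ, ∀ n v, 0 < v → |Finsupp.linearCombination ℝ (ind v) (c n)| ≤
      (Iio T).indicator (fun _ => C) v) ∧
    ∀ᵐ v ∂volume.restrict (Ioi 0),
      Tendsto (fun n => Finsupp.linearCombination ℝ (ind v) (c n)) atTop (𝓝 (h v))

lemma IsWienerLimit.zero : IsWienerLimit w P 0 0 :=
  ⟨0, by simp, ⟨0, 0, by simp⟩, by simp⟩

lemma IsWienerLimit.congr {h h' : ℝ → ℝ} {U U' : Ω → ℝ} (hU : IsWienerLimit w P h U)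
    (h1 : ∀ᵐ v ∂volume.restrict (Ioi 0), h v = h' v) (h2 : ∀ᵐ ω ∂P, U ω = U' ω) :
    IsWienerLimit w P h' U' := by
  obtain ⟨c, hc1, hc2, hc3⟩ := hU
  refine ⟨c, ?_, hc2, ?_⟩
  · filter_upwards [hc1, h2] with ω h3 h4
    rwa [← h4]
  · filter_upwards [hc3, h1] with ω h3 h4
    rwa [← h4]

/-- Linearity reduces joint laws and covariances to the one-dimensional `IsWienerLimit.hasLaw`. -/
lemma IsWienerLimit.add_mul {h h' : ℝ → ℝ} {U U' : Ω → ℝ} (hU : IsWienerLimit w P h U)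
    (hU' : IsWienerLimit w P h' U') (α β : ℝ) :
    IsWienerLimit w P (fun v => α * h v + β * h' v) (fun ω => α * U ω + β * U' ω) := by
  obtain ⟨c, hc1, ⟨C, T, hc2⟩, hc3⟩ := hU
  obtain ⟨d, hd1, ⟨D, R, hd2⟩, hd3⟩ := hU'
  refine ⟨fun n => α • c n + β • d n, ?_, ⟨|α| * |C| + |β| * |D|, max T R, fun n v hv => ?_⟩, ?_⟩
  · filter_upwards [hc1, hd1] with ω h3 h4
    simpa only [map_add, map_smul, smul_eq_mul] using (h3.const_mul α).add (h4.const_mul β)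
  · have h5 := hc2 n v hv
    have h6 := hd2 n v hv
    simp only [map_add, map_smul, smul_eq_mul]
    refine (abs_add_le _ _).trans ?_
    rw [abs_mul, abs_mul]
    by_cases hvT : v < max T R
    · rw [indicator_of_mem (show v ∈ Iio (max T R) from hvT)]
      have h7 : ∀ E Q : ℝ, (Iio Q).indicator (fun _ => E) v ≤ |E| := fun E Q => by
        simp only [indicator_apply]
        split_ifs
        · exact le_abs_self E
        · exact abs_nonneg E
      exact add_le_add (mul_le_mul_of_nonneg_left (h5.trans (h7 _ _)) (abs_nonneg _))
        (mul_le_mul_of_nonneg_left (h6.trans (h7 _ _)) (abs_nonneg _))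
    · rw [indicator_of_notMem (show v ∉ Iio (max T R) from hvT)]
      rw [not_lt, max_le_iff] at hvT
      rw [indicator_of_notMem (show v ∉ Iio T from not_lt.2 hvT.1)] at h5
      rw [indicator_of_notMem (show v ∉ Iio R from not_lt.2 hvT.2)] at h6
      rw [le_antisymm h5 (abs_nonneg _), le_antisymm h6 (abs_nonneg _)]
      simp
  · filter_upwards [hc3, hd3] with ω h3 h4
    simpa only [map_add, map_smul, smul_eq_mul] using (h3.const_mul α).add (h4.const_mul β)

lemma measurable_linearCombination_ind (c : ℝ≥0 →₀ ℝ) :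
    Measurable fun v => Finsupp.linearCombination ℝ (ind v) c := by
  simp only [Finsupp.linearCombination_apply, Finsupp.sum, smul_eq_mul]
  refine Finset.measurable_sum _ fun s _ => Measurable.const_mul ?_ _
  exact Measurable.ite measurableSet_Iio measurable_const measurable_const

/-- The Wiener integral of `h` is a centred Gaussian variable with variance `∫ h²`. -/
lemma IsWienerLimit.hasLaw [IsProbabilityMeasure P] (hw : IsBrownianReal w P) {h : ℝ → ℝ}
    {U : Ω → ℝ} (hU : IsWienerLimit w P h U) :
    HasLaw U (gaussianReal 0 (∫ v in Ioi 0, h v ^ 2).toNNReal) P := by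
  obtain ⟨c, hc1, ⟨C, T, hc2⟩, hc3⟩ := hU
  refine hasLaw_gaussianReal_of_tendsto (fun n => hasLaw_linearCombination hw (c n)) hc1 ?_
  refine (continuous_real_toNNReal.tendsto _).comp ?_
  -- The uniform bound and common support required in `IsWienerLimit` provide the majorant for the
  -- variances.
  refine tendsto_integral_of_dominated_convergence ((Iio T).indicator fun _ => C ^ 2)
    (fun n => ((measurable_linearCombination_ind (c n)).pow_const 2).aestronglyMeasurable) ?_
    (fun n => ?_) ?_
  · rw [← IntegrableOn, integrableOn_indicator_iff measurableSet_Iio, inter_comm, Ioi_inter_Iio]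
    exact integrableOn_const (by simp)
  · filter_upwards [ae_restrict_mem measurableSet_Ioi] with v hv
    have := hc2 n v hv
    rw [norm_pow, Real.norm_eq_abs]
    by_cases hvT : v ∈ Iio T
    · rw [indicator_of_mem hvT] at this ⊢
      gcongr
    · rw [indicator_of_notMem hvT] at this ⊢
      rw [le_antisymm this (abs_nonneg _)]
      simp
  · filter_upwards [hc3] with v hv using hv.pow 2

end WienerLimit

/-! ### The noise response as a Wiener integral -/

section NoiseLimit

variable {Ω : Type*} [MeasurableSpace Ω] {P : Measure Ω} {w : ℝ≥0 → Ω → ℝ} {a b τ : ℝ}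

/-- The path of `w` extended by its value at `0` to negative times. -/
def path (w : ℝ≥0 → Ω → ℝ) (ω : Ω) (t : ℝ) : ℝ := w t.toNNReal ω

lemma ae_path (hw : IsBrownianReal w P) :
    ∀ᵐ ω ∂P, Continuous (path w ω) ∧ ∀ t ≤ 0, path w ω t = 0 := by
  filter_upwards [hw.cont, hw.eval_zero_ae_eq_zero] with ω h1 h2
  exact ⟨h1.comp continuous_real_toNNReal, fun t ht => by
    rw [path, Real.toNNReal_of_nonpos ht, h2]⟩

/-- The noise response at time `t` is the Wiener integral of `X(t - ·)`. -/
lemma isWienerLimit_noise (hw : IsBrownianReal w P) (hτ : 0 < τ) (t : ℝ) :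
    IsWienerLimit w P (fun v => X a b τ (t - v)) (fun ω => noise a b τ (path w ω) t) := by
  rcases le_or_gt t 0 with ht | ht
  · refine IsWienerLimit.zero.congr ?_ ?_
    · filter_upwards [ae_restrict_mem measurableSet_Ioi] with v hv
      exact (X_of_neg (by linarith [mem_Ioi.1 hv])).symm
    · filter_upwards [ae_path hw] with ω hω
      exact (noise_of_nonpos hτ hω.2 ht).symm
  set g : ℝ → ℝ := fun u => kernel a b τ (t - u) with hg
  have hgi : IntervalIntegrable g volume 0 t := by
    simpa [hg] using ((intervalIntegrable_kernel (a := a) (b := b) hτ 0 t).comp_sub_left t).symm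
  set κ : ℕ → ℕ → ℝ := fun n i =>
    ∫ u in (i : ℝ) * (t / (n + 1 : ℕ))..(i + 1 : ℕ) * (t / (n + 1 : ℕ)), g u with hκ
  -- A Riemann sum for `W t + ∫₀ᵗ kernel(t - u) W u du`. The kernel is integrated exactly over each
  -- cell, so its continuity is not needed.
  set c : ℕ → ℝ≥0 →₀ ℝ := fun n => Finsupp.single t.toNNReal 1 + ∑ i ∈ Finset.range (n + 1),
    Finsupp.single (i * (t / (n + 1 : ℕ))).toNNReal (κ n i) with hc
  -- Stated for arbitrary `f` because it serves twice: for the path of `w` and for the indicator `r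
  -- ↦ 1_{v < r}`.
  have hlc : ∀ (f : ℝ → ℝ) (n : ℕ), Finsupp.linearCombination ℝ (fun s : ℝ≥0 => f s) (c n) =
      f t + ∑ i ∈ Finset.range (n + 1), κ n i * f (i * (t / (n + 1 : ℕ))) := fun f n => by
    simp only [hc, map_add, map_sum, Finsupp.linearCombination_single, one_mul, smul_eq_mul,
      Real.coe_toNNReal _ ht.le]
    congr 1
    refine Finset.sum_congr rfl fun i _ => ?_
    rw [Real.coe_toNNReal _ (by positivity)]
  have htag : ∀ n i : ℕ, i ∈ Finset.range (n + 1) → (i : ℝ) * (t / (n + 1 : ℕ)) ≤ t := by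
    intro n i hi
    have h1 : (i : ℝ) ≤ (n + 1 : ℕ) := by exact_mod_cast (Finset.mem_range.1 hi).le
    calc (i : ℝ) * (t / (n + 1 : ℕ)) ≤ (n + 1 : ℕ) * (t / (n + 1 : ℕ)) := by gcongr
      _ = t := by have hn : ((n + 1 : ℕ) : ℝ) ≠ 0 := by positivity
                  field_simp
  obtain ⟨K, hK0, hK⟩ := exists_kernel_bound a b hτ t
  have hκ_bound : ∀ n, ∑ i ∈ Finset.range (n + 1), |κ n i| ≤ K * t := fun n => by
    have h1 : ∀ i ∈ Finset.range (n + 1), |κ n i| ≤ K * (t / (n + 1 : ℕ)) := fun i _ => by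
      have := intervalIntegral.norm_integral_le_of_norm_le_const (C := K) (f := g)
        (a := (i : ℝ) * (t / (n + 1 : ℕ))) (b := (i + 1 : ℕ) * (t / (n + 1 : ℕ))) fun u hu => by
          have hd : 0 < t / (n + 1 : ℕ) := by positivity
          have hle : (i : ℝ) * (t / (n + 1 : ℕ)) ≤ (i + 1 : ℕ) * (t / (n + 1 : ℕ)) := by
            push_cast at hd ⊢; nlinarith
          rw [uIoc_of_le hle] at hu
          have h0 : (0 : ℝ) ≤ (i : ℝ) * (t / (n + 1 : ℕ)) := by positivity
          exact hK _ (by linarith [hu.1])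
      refine this.trans_eq ?_
      rw [← sub_mul]
      push_cast
      rw [add_sub_cancel_left, one_mul, abs_of_pos (by positivity)]
    refine (Finset.sum_le_sum h1).trans_eq ?_
    rw [Finset.sum_const, Finset.card_range, nsmul_eq_mul]
    have hn : ((n + 1 : ℕ) : ℝ) ≠ 0 := by positivity
    field_simp
  refine ⟨c, ?_, ⟨1 + K * t, t, ?_⟩, ?_⟩
  · filter_upwards [ae_path hw] with ω hω
    have hpath : (fun s => w s ω) = fun s : ℝ≥0 => path w ω s := by
      ext s; simp [path]
    obtain ⟨M, hM⟩ := isCompact_Icc.exists_bound_of_continuousOn (hω.1.continuousOn (s := Icc 0 t))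
    simp_rw [hpath, hlc (path w ω)]
    rw [noise_eq_add_integral hτ hω.1 ht.le]
    exact (tendsto_weighted_riemann_sum ht hgi hM
      (Eventually.of_forall fun u _ => hω.1.continuousAt)).const_add _
  · intro n v hv
    have hind : ind v = fun s : ℝ≥0 => (fun r : ℝ => if v < r then (1 : ℝ) else 0) s := rfl
    rw [hind, hlc (fun r : ℝ => if v < r then (1 : ℝ) else 0)]
    by_cases hvt : v < t
    · rw [indicator_of_mem (show v ∈ Iio t from hvt)]
      refine (abs_add_le _ _).trans (add_le_add (by simp [hvt]) ?_)
      refine (Finset.abs_sum_le_sum_abs _ _).trans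
        ((Finset.sum_le_sum fun i _ => ?_).trans (hκ_bound n))
      rw [abs_mul]
      refine mul_le_of_le_one_right (abs_nonneg _) ?_
      split_ifs <;> simp
    · rw [indicator_of_notMem (show v ∉ Iio t from hvt), if_neg hvt, zero_add,
        Finset.sum_eq_zero, abs_zero]
      intro i hi
      rw [if_neg (not_lt.2 ((htag n i hi).trans (not_lt.1 hvt))), mul_zero]
  · filter_upwards [ae_restrict_mem measurableSet_Ioi,
      ae_restrict_of_ae (compl_mem_ae_iff.2 (measure_singleton t))] with v hv hvt
    have hv0 : 0 < v := hv
    have hind : ind v = fun s : ℝ≥0 => (fun r : ℝ => if v < r then (1 : ℝ) else 0) s := rfl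
    simp_rw [hind, hlc (fun r : ℝ => if v < r then (1 : ℝ) else 0)]
    have hlim := tendsto_weighted_riemann_sum (f := fun r : ℝ => if v < r then (1 : ℝ) else 0)
      (M := 1) ht hgi (fun s _ => by split_ifs <;> simp) (by
        filter_upwards [compl_mem_ae_iff.2 (measure_singleton v)] with u hu _
        rcases lt_or_gt_of_ne (show u ≠ v from hu) with h | h
        · refine (continuousAt_const (y := (0 : ℝ))).congr ?_
          filter_upwards [Iio_mem_nhds h] with r hr
          rw [if_neg (not_lt.2 (le_of_lt hr))]
        · refine (continuousAt_const (y := (1 : ℝ))).congr ?_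
          filter_upwards [Ioi_mem_nhds h] with r hr
          rw [if_pos (mem_Ioi.1 hr)])
    -- For `v < t` the limit is `1 + ∫ᵥᵗ kernel(t - u) du = 1 + (X(t - v) - 1)`; for `v > t`
    -- everything vanishes. The point `v = t` was excluded, since `X(0) = 1` there while the limit
    -- is `0`.
    convert hlim.const_add (if v < t then (1 : ℝ) else 0) using 2
    rcases lt_or_ge v t with h | h
    · have h1 : ∫ u in (0 : ℝ)..v, g u * (if v < u then (1 : ℝ) else 0) = 0 := by
        refine intervalIntegral.integral_zero_ae (Eventually.of_forall fun u hu => ?_)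
        rw [uIoc_of_le hv0.le] at hu
        rw [if_neg (not_lt.2 hu.2), mul_zero]
      have h2 : ∫ u in v..t, g u * (if v < u then (1 : ℝ) else 0) = ∫ u in v..t, g u := by
        refine intervalIntegral.integral_congr_ae (Eventually.of_forall fun u hu => ?_)
        rw [uIoc_of_le h.le] at hu
        rw [if_pos hu.1, mul_one]
      have h3 : IntervalIntegrable (fun u => g u * (if v < u then (1 : ℝ) else 0)) volume 0 t := by
        refine hgi.abs.mono_fun' ?_ (Eventually.of_forall fun u => ?_)
        · exact (intervalIntegrable_iff.1 hgi).aestronglyMeasurable.mul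
            (Measurable.ite measurableSet_Ioi measurable_const measurable_const).aestronglyMeasurable
        · beta_reduce
          rw [norm_mul]
          refine mul_le_of_le_one_right (norm_nonneg _) ?_
          split_ifs <;> simp
      rw [if_pos h, ← intervalIntegral.integral_add_adjacent_intervals (b := v)
        (h3.mono_set (by rw [uIcc_of_le hv0.le, uIcc_of_le ht.le]; exact Icc_subset_Icc_right h.le))
        (h3.mono_set (by rw [uIcc_of_le h.le, uIcc_of_le ht.le]; exact Icc_subset_Icc_left hv0.le)),
        h1, h2, hg, intervalIntegral.integral_comp_sub_left (fun u => kernel a b τ u) t, sub_self,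
        integral_kernel hτ (sub_nonneg.2 h.le)]
      ring
    · have h' : t < v := lt_of_le_of_ne h (Ne.symm hvt)
      rw [if_neg (not_lt.2 h), zero_add, X_of_neg (sub_neg.2 h'), eq_comm]
      refine intervalIntegral.integral_zero_ae (Eventually.of_forall fun u hu => ?_)
      rw [uIoc_of_le ht.le] at hu
      rw [if_neg (not_lt.2 (hu.2.trans h)), mul_zero]

end NoiseLimit

/-! ### The covariance function and nondegeneracy -/

section CovarianceFunction

variable {a b τ : ℝ}

lemma integrableOn_X_sub_mul (hτ : 0 < τ) (p q : ℝ) :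
    IntegrableOn (fun v => X a b τ (p - v) * X a b τ (q - v)) (Ioi 0) := by
  obtain ⟨C, hC0, hC⟩ := exists_X_bound a b hτ p
  obtain ⟨D, hD0, hD⟩ := exists_X_bound a b hτ q
  have hX := measurable_X (a := a) (b := b) hτ
  refine IntegrableOn.of_forall_sdiff_eq_zero (s := Ioc 0 p) ?_ measurableSet_Ioi fun v hv => ?_
  · refine Measure.integrableOn_of_bounded (M := C * D) (by simp) (by fun_prop) ?_
    filter_upwards [ae_restrict_mem measurableSet_Ioc] with v hv
    rw [norm_mul]
    exact mul_le_mul (hC _ (by linarith [hv.1])) (hD _ (by linarith [hv.1])) (norm_nonneg _) hC0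
  · have : p < v := by
      by_contra! h
      exact hv.2 ⟨hv.1, h⟩
    rw [X_of_neg (by linarith), zero_mul]

lemma integral_X_sub_mul (p q : ℝ) :
    ∫ v in Ioi 0, X a b τ (p - v) * X a b τ (q - v) =
      if p ≤ 0 then 0 else ∫ z in (0 : ℝ)..p, X a b τ z * X a b τ (z + (q - p)) := by
  split_ifs with hp
  · refine setIntegral_eq_zero_of_forall_eq_zero fun v hv => ?_
    rw [X_of_neg (by linarith [mem_Ioi.1 hv]), zero_mul]
  · rw [not_le] at hp
    rw [setIntegral_eq_of_subset_of_forall_sdiff_eq_zero measurableSet_Ioi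
      (Ioc_subset_Ioi_self : Ioc 0 p ⊆ Ioi 0), ← intervalIntegral.integral_of_le hp.le]
    · have := intervalIntegral.integral_comp_sub_left
        (fun z => X a b τ z * X a b τ (z + (q - p))) p (a := 0) (b := p)
      rw [sub_self, sub_zero] at this
      rw [← this]
      refine intervalIntegral.integral_congr fun v _ => ?_
      rw [show p - v + (q - p) = q - v by ring]
    · intro v hv
      have : p < v := by
        by_contra! h
        exact hv.2 ⟨hv.1, h⟩
      rw [X_of_neg (by linarith), zero_mul]

/-- The covariance function as an inner product of shifted fundamental solutions. -/
lemma r_eq_integral (σ t s₁ s₂ : ℝ) : r a b σ τ t s₁ s₂ =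
    σ ^ 2 * ∫ v in Ioi 0, X a b τ (t + s₁ - v) * X a b τ (t + s₂ - v) := by
  wlog h : s₁ ≤ s₂ generalizing s₁ s₂
  · have := this s₂ s₁ (le_of_not_ge h)
    rw [show r a b σ τ t s₁ s₂ = r a b σ τ t s₂ s₁ by rw [r, r, min_comm, abs_sub_comm], this]
    simp_rw [mul_comm]
  rw [integral_X_sub_mul, r, min_eq_left h, abs_of_nonneg (sub_nonneg.2 h),
    show t + s₂ - (t + s₁) = s₂ - s₁ by ring]
  split_ifs <;> simp

lemma r_comm (σ t s₁ s₂ : ℝ) : r a b σ τ t s₁ s₂ = r a b σ τ t s₂ s₁ := by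
  rw [r, r, min_comm, abs_sub_comm]

lemma r_of_nonpos {σ t s₁ s₂ : ℝ} (h : t + min s₁ s₂ ≤ 0) : r a b σ τ t s₁ s₂ = 0 := if_pos h

lemma υ_eq {σ t : ℝ} (ht : 0 < t) :
    υ a b σ τ t = σ ^ 2 * ∫ q in (0 : ℝ)..t, X a b τ q ^ 2 := by
  rw [υ, r, min_self, add_zero, if_neg ht.not_ge]
  simp [sq]

lemma r_neg_delay_eq {σ t : ℝ} (hτ : 0 < τ) (ht : τ < t) :
    r a b σ τ t (-τ) 0 = σ ^ 2 * ∫ q in (0 : ℝ)..(t - τ), X a b τ q * X a b τ (q + τ) := by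
  rw [r, min_eq_left (by linarith), if_neg (by linarith), zero_sub, neg_neg, abs_of_pos hτ]
  rfl

lemma r_delay_delay_eq (σ t : ℝ) : r a b σ τ t (-τ) (-τ) = υ a b σ τ (t - τ) := by
  simp [υ, r, sub_eq_add_neg]

lemma det_Q (σ t : ℝ) : (Q a b σ τ t).det =
    υ a b σ τ t * υ a b σ τ (t - τ) - r a b σ τ t (-τ) 0 ^ 2 := by
  rw [Q, Matrix.det_fin_two_of, r_delay_delay_eq, r_comm σ t 0 (-τ)]
  simp only [υ]
  ring

lemma intervalIntegrable_X_mul_X (hτ : 0 < τ) (c p q : ℝ) :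
    IntervalIntegrable (fun z => X a b τ z * X a b τ (z + c)) volume p q := by
  obtain ⟨C, hC0, hC⟩ := exists_X_bound a b hτ (max p q)
  obtain ⟨D, hD0, hD⟩ := exists_X_bound a b hτ (max p q + c)
  refine intervalIntegrable_of_bound (C := C * D)
    ((measurable_X hτ).mul ((measurable_X hτ).comp (measurable_id.add_const c))) fun z hz => ?_
  rw [Pi.mul_apply, abs_mul]
  exact mul_le_mul (hC _ hz.2) (hD _ (by simpa using hz.2)) (abs_nonneg _) hC0

lemma intervalIntegrable_X_sq (hτ : 0 < τ) (p q : ℝ) :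
    IntervalIntegrable (fun z => X a b τ z ^ 2) volume p q := by
  simpa [sq] using intervalIntegrable_X_mul_X (a := a) (b := b) hτ 0 p q

lemma integral_X_sq_pos (hτ : 0 < τ) {t : ℝ} (ht : 0 < t) :
    0 < ∫ q in (0 : ℝ)..t, X a b τ q ^ 2 := by
  refine intervalIntegral.integral_pos ht (((continuousOn_X hτ).mono Icc_subset_Ici_self).pow 2)
    (fun q _ => sq_nonneg _) ⟨0, ⟨le_rfl, ht.le⟩, by simp [X_zero]⟩

lemma υ_pos {σ t : ℝ} (hσ : σ ≠ 0) (hτ : 0 < τ) (ht : 0 < t) : 0 < υ a b σ τ t := by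
  rw [υ_eq ht]
  have := integral_X_sq_pos (a := a) (b := b) hτ ht
  positivity

/-- The Cauchy–Schwarz inequality for interval integrals. -/
lemma sq_integral_mul_le {f g : ℝ → ℝ} {p q : ℝ} (hpq : p ≤ q)
    (hf : IntervalIntegrable (fun z => f z ^ 2) volume p q)
    (hg : IntervalIntegrable (fun z => g z ^ 2) volume p q)
    (hfg : IntervalIntegrable (fun z => f z * g z) volume p q) :
    (∫ z in p..q, f z * g z) ^ 2 ≤ (∫ z in p..q, f z ^ 2) * ∫ z in p..q, g z ^ 2 := by
  have key : ∀ c : ℝ, 0 ≤ (∫ z in p..q, g z ^ 2) * (c * c) + (2 * ∫ z in p..q, f z * g z) * c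
      + ∫ z in p..q, f z ^ 2 := fun c => by
    have h : 0 ≤ ∫ z in p..q, (f z + c * g z) ^ 2 :=
      intervalIntegral.integral_nonneg hpq fun z _ => sq_nonneg _
    have e : ∫ z in p..q, (f z + c * g z) ^ 2 =
        ∫ z in p..q, (f z ^ 2 + ((2 * c) * (f z * g z) + c ^ 2 * g z ^ 2)) :=
      intervalIntegral.integral_congr fun z _ => by ring
    rw [e, intervalIntegral.integral_add hf ((hfg.const_mul _).add (hg.const_mul _)),
      intervalIntegral.integral_add (hfg.const_mul _) (hg.const_mul _),
      intervalIntegral.integral_const_mul, intervalIntegral.integral_const_mul] at h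
    linarith
  have := discrim_le_zero key
  rw [discrim] at this
  linarith

/-- Cauchy–Schwarz on `[0, t - τ]` for `X` and its shift by `τ`. The shifted square is integrated
over `[τ, t]` only, which accounts for the subtracted `υ(τ)`. -/
lemma r_sq_le {σ t : ℝ} (hτ : 0 < τ) (ht : τ < t) : r a b σ τ t (-τ) 0 ^ 2 ≤
    υ a b σ τ (t - τ) * (υ a b σ τ t - υ a b σ τ τ) := by
  have h0 := sq_integral_mul_le (f := X a b τ) (g := fun q => X a b τ (q + τ)) (p := 0)
    (q := t - τ) (by linarith) (intervalIntegrable_X_sq hτ _ _)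
    (by simpa using (intervalIntegrable_X_sq (a := a) (b := b) hτ τ t).comp_add_right τ)
    (intervalIntegrable_X_mul_X hτ τ _ _)
  have h1 : ∫ q in (0 : ℝ)..(t - τ), X a b τ (q + τ) ^ 2 = ∫ q in τ..t, X a b τ q ^ 2 := by
    have := intervalIntegral.integral_comp_add_right (fun q => X a b τ q ^ 2) τ (a := 0) (b := t - τ)
    simpa using this
  have h2 := intervalIntegral.integral_add_adjacent_intervals
    (intervalIntegrable_X_sq (a := a) (b := b) hτ 0 τ) (intervalIntegrable_X_sq hτ τ t)
  rw [r_neg_delay_eq hτ ht, υ_eq (by linarith), υ_eq (by linarith), υ_eq hτ, ← h2, ← h1]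
  have h3 := mul_le_mul_of_nonneg_left h0 (by positivity : 0 ≤ σ ^ 2 * σ ^ 2)
  linarith

lemma det_Q_pos {σ t : ℝ} (hσ : σ ≠ 0) (hτ : 0 < τ) (ht : τ < t) : 0 < (Q a b σ τ t).det := by
  have h1 := r_sq_le (a := a) (b := b) (σ := σ) hτ ht
  have h2 := mul_pos (υ_pos (a := a) (b := b) hσ hτ (sub_pos.2 ht)) (υ_pos (a := a) (b := b) hσ hτ hτ)
  rw [det_Q]
  linarith

end CovarianceFunction

/-! ### Gaussian pairs: regression, density, conditional expectation -/

section GaussianPair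

variable {Ω : Type*} [MeasurableSpace Ω] {P : Measure Ω} {w : ℝ≥0 → Ω → ℝ}

/-- Cramér–Wold: each linear functional of the pair is again a Wiener limit. -/
lemma IsWienerLimit.hasGaussianLaw_prodMk [IsProbabilityMeasure P] (hw : IsBrownianReal w P)
    {h h' : ℝ → ℝ} {U U' : Ω → ℝ} (hU : IsWienerLimit w P h U) (hU' : IsWienerLimit w P h' U') :
    HasGaussianLaw (fun ω => (U ω, U' ω)) P := by
  have hm := (hU.hasLaw hw).aemeasurable.prodMk (hU'.hasLaw hw).aemeasurable
  refine ⟨isGaussian_of_map_eq_gaussianReal fun L =>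
    ⟨0, (∫ v in Ioi 0, (L (1, 0) * h v + L (0, 1) * h' v) ^ 2).toNNReal, ?_⟩⟩
  rw [AEMeasurable.map_map_of_aemeasurable (by fun_prop) hm,
    ← ((hU.add_mul hU' (L (1, 0)) (L (0, 1))).hasLaw hw).map_eq]
  congr 1
  ext ω
  have : ((U ω, U' ω) : ℝ × ℝ) = U ω • (1, 0) + U' ω • (0, 1) := by simp
  rw [Function.comp_apply, this, map_add, map_smul, map_smul, smul_eq_mul, smul_eq_mul]
  ring

/-- Polarization: the variances of `U`, `U'` and `U + U'` are known. -/
lemma IsWienerLimit.covariance_eq [IsProbabilityMeasure P] (hw : IsBrownianReal w P)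
    {h h' : ℝ → ℝ} {U U' : Ω → ℝ} (hU : IsWienerLimit w P h U) (hU' : IsWienerLimit w P h' U')
    (h1 : IntegrableOn (fun v => h v ^ 2) (Ioi 0)) (h2 : IntegrableOn (fun v => h' v ^ 2) (Ioi 0))
    (h3 : IntegrableOn (fun v => h v * h' v) (Ioi 0)) :
    cov[U, U'; P] = ∫ v in Ioi 0, h v * h' v := by
  have hvar : ∀ {g : ℝ → ℝ} {Z : Ω → ℝ}, IsWienerLimit w P g Z →
      Var[Z; P] = ∫ v in Ioi 0, g v ^ 2 := fun hZ => by
    rw [(hZ.hasLaw hw).variance_eq, variance_id_gaussianReal, Real.coe_toNNReal]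
    exact integral_nonneg fun v => sq_nonneg _
  have hs := hvar (hU.add_mul hU' 1 1)
  simp only [one_mul] at hs
  rw [variance_fun_add (hU.hasLaw hw).hasGaussianLaw.memLp_two
    (hU'.hasLaw hw).hasGaussianLaw.memLp_two, hvar hU, hvar hU'] at hs
  have e : ∀ v, (h v + h' v) ^ 2 = h v ^ 2 + (2 * (h v * h' v) + h' v ^ 2) := fun v => by ring
  simp_rw [e] at hs
  have h4 : Integrable (fun v => 2 * (h v * h' v) + h' v ^ 2) (volume.restrict (Ioi 0)) :=
    (h3.const_mul 2).add h2
  rw [integral_add h1 h4, integral_add (h3.const_mul 2) h2,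
    integral_const_mul] at hs
  linarith

/-- The regression residual `Y - (cov / var) U` of a Gaussian pair is Gaussian and independent
of `U`. -/
lemma residual_of_hasGaussianLaw [IsProbabilityMeasure P] {U Y : Ω → ℝ} {m₁ m₂ v c u : ℝ}
    (hG : HasGaussianLaw (fun ω => (U ω, Y ω)) P) (hm₁ : P[U] = m₁) (hm₂ : P[Y] = m₂)
    (hv : Var[U; P] = v) (hc : cov[U, Y; P] = c) (hu : Var[Y; P] = u) (hv0 : 0 < v) :
    IndepFun U (fun ω => Y ω - c / v * U ω) P ∧
      P.map (fun ω => Y ω - c / v * U ω) =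
        gaussianReal (m₂ - c / v * m₁) (u - c ^ 2 / v).toNNReal := by
  have hU := hG.fst.memLp_two
  have hY := hG.snd.memLp_two
  have hcU : MemLp (fun ω => c / v * U ω) 2 P := hU.const_mul _
  have hG' : HasGaussianLaw (fun ω => (U ω, Y ω - c / v * U ω)) P := by
    exact hG.map_fun ((ContinuousLinearMap.fst ℝ ℝ ℝ).prod
      (ContinuousLinearMap.snd ℝ ℝ ℝ - (c / v) • ContinuousLinearMap.fst ℝ ℝ ℝ))
  refine ⟨hG'.indepFun_of_covariance_eq_zero ?_, ?_⟩
  · rw [covariance_fun_sub_right hU hY hcU, covariance_const_mul_right,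
      covariance_self hU.aemeasurable, hc, hv]
    field_simp
    ring
  · rw [hG'.snd.map_eq_gaussianReal]
    congr 2
    · rw [integral_sub (hY.integrable (by norm_num)) (hcU.integrable (by norm_num)),
        integral_const_mul, hm₁, hm₂]
    · rw [variance_fun_sub hY hcU, variance_const_mul, covariance_const_mul_right, covariance_comm,
        hu, hv, hc]
      field_simp
      ring

/-- The density of a nondegenerate Gaussian pair, factorized into marginal and conditional
densities. -/
lemma map_prodMk_of_hasGaussianLaw [IsProbabilityMeasure P] {U Y : Ω → ℝ} {m₁ m₂ v c u : ℝ}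
    (hG : HasGaussianLaw (fun ω => (U ω, Y ω)) P) (hm₁ : P[U] = m₁) (hm₂ : P[Y] = m₂)
    (hv : Var[U; P] = v) (hc : cov[U, Y; P] = c) (hu : Var[Y; P] = u) (hv0 : 0 < v)
    (hd : 0 < u - c ^ 2 / v) :
    P.map (fun ω => (U ω, Y ω)) = volume.withDensity fun z : ℝ × ℝ => ENNReal.ofReal
      (gaussianPDFReal m₁ v.toNNReal z.1 *
        gaussianPDFReal (m₂ + c / v * (z.1 - m₁)) (u - c ^ 2 / v).toNNReal z.2) := by
  obtain ⟨hind, hres⟩ := residual_of_hasGaussianLaw hG hm₁ hm₂ hv hc hu hv0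
  have hUm := hG.fst.aemeasurable
  have hYm := hG.snd.aemeasurable
  have hRm : AEMeasurable (fun ω => Y ω - c / v * U ω) P := hYm.sub (hUm.const_mul _)
  have hprod := (indepFun_iff_map_prod_eq_prod_map_map hUm hRm).1 hind
  rw [hres, hG.fst.map_eq_gaussianReal, hm₁, hv,
    gaussianReal_of_var_ne_zero _ (by simpa using hv0),
    gaussianReal_of_var_ne_zero _ (by simpa using hd),
    prod_withDensity (measurable_gaussianPDF _ _) (measurable_gaussianPDF _ _)] at hprod
  -- This shear rebuilds `(U, Y)` from `U` and the independent residual. It preserves Lebesgue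
  -- measure, so the product density is transported without a Jacobian factor.
  let T : ℝ × ℝ → ℝ × ℝ := fun z => (z.1, c / v * z.1 + z.2)
  have hT : MeasurePreserving T volume volume :=
    MeasurePreserving.skew_product (g := fun x y => c / v * x + y) (MeasurePreserving.id volume)
      (by fun_prop) (Eventually.of_forall fun x => map_add_left_eq_self volume _)
  have hpair : (fun ω => (U ω, Y ω)) = T ∘ fun ω => (U ω, Y ω - c / v * U ω) := by
    ext ω <;> simp [T]
  rw [hpair, ← AEMeasurable.map_map_of_aemeasurable hT.measurable.aemeasurable (hUm.prodMk hRm),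
    hprod]
  ext s hs
  rw [Measure.map_apply hT.measurable hs, withDensity_apply _ (hT.measurable hs),
    withDensity_apply _ hs, ← hT.setLIntegral_comp_preimage hs ?_]
  · refine lintegral_congr fun z => ?_
    simp only [T, gaussianPDF]
    rw [← ENNReal.ofReal_mul (gaussianPDFReal_nonneg _ _ _), add_comm (c / v * z.1),
      gaussianPDFReal_add]
    congr 3
    ring
  · refine ENNReal.measurable_ofReal.comp ?_
    unfold gaussianPDFReal
    fun_prop

/-- The conditional expectation in a Gaussian pair is the linear regression. -/
lemma condExp_of_hasGaussianLaw [IsProbabilityMeasure P] {U Y : Ω → ℝ} {m₁ m₂ v c u : ℝ}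
    (hG : HasGaussianLaw (fun ω => (U ω, Y ω)) P) (hm₁ : P[U] = m₁) (hm₂ : P[Y] = m₂)
    (hv : Var[U; P] = v) (hc : cov[U, Y; P] = c) (hu : Var[Y; P] = u) (hv0 : 0 < v)
    (hUm : Measurable U) (hYm : Measurable Y) :
    P[Y | MeasurableSpace.comap U inferInstance] =ᵐ[P] fun ω => m₂ + c / v * (U ω - m₁) := by
  obtain ⟨hind, -⟩ := residual_of_hasGaussianLaw hG hm₁ hm₂ hv hc hu hv0
  have hUi : Integrable (fun ω => c / v * U ω) P := hG.fst.integrable.const_mul _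
  have hYi := hG.snd.integrable
  have hRm : Measurable fun ω => Y ω - c / v * U ω := hYm.sub (hUm.const_mul _)
  -- `Y` is the sum of the residual, whose conditional expectation is constant by independence, and
  -- a multiple of `U`, which is measurable for the conditioning σ-algebra.
  have h1 : P[fun ω => Y ω - c / v * U ω | MeasurableSpace.comap U inferInstance] =ᵐ[P]
      fun _ => m₂ - c / v * m₁ := by
    refine (condExp_indep_eq hRm.comap_le hUm.comap_le
      (comap_measurable _).stronglyMeasurable hind.symm).trans (Eventually.of_forall fun ω => ?_)
    simp only
    rw [integral_sub hYi hUi, integral_const_mul, hm₁, hm₂]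
  have h2 : P[fun ω => c / v * U ω | MeasurableSpace.comap U inferInstance] =
      fun ω => c / v * U ω :=
    condExp_of_stronglyMeasurable hUm.comap_le
      ((comap_measurable U).const_mul _).stronglyMeasurable hUi
  have h3 := condExp_add (hYi.sub hUi) hUi (MeasurableSpace.comap U inferInstance)
  have h4 : (Y - fun ω => c / v * U ω) + (fun ω => c / v * U ω) = Y := by ext ω; simp
  rw [h4, h2] at h3
  filter_upwards [h3, h1] with ω h5 h6
  rw [h5, Pi.add_apply]
  change P[fun ω => Y ω - c / v * U ω | MeasurableSpace.comap U inferInstance] ω + _ = _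
  rw [h6]
  ring

end GaussianPair

/-! ### Fokker–Planck equations of Gaussian densities with affine drift -/

section FokkerPlanck

lemma gaussianPDFReal_toNNReal {m v : ℝ} (hv : 0 < v) (z : ℝ) :
    gaussianPDFReal m v.toNNReal z =
      (√(2 * Real.pi * v))⁻¹ * Real.exp (-(z - m) ^ 2 / (2 * v)) := by
  rw [gaussianPDFReal, Real.coe_toNNReal _ hv.le]

lemma gaussianPDFReal_toNNReal_pos {m v : ℝ} (hv : 0 < v) (z : ℝ) :
    0 < gaussianPDFReal m v.toNNReal z :=
  gaussianPDFReal_pos _ _ _ (by simpa using hv)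

/-- The derivative of a Gaussian density along differentiable paths of means and variances. -/
lemma hasDerivAt_gaussianPDFReal_path {m v : ℝ → ℝ} {m' v' t : ℝ} (hm : HasDerivAt m m' t)
    (hv : HasDerivAt v v' t) (hpos : 0 < v t) (ξ : ℝ) :
    HasDerivAt (fun s => gaussianPDFReal (m s) (v s).toNNReal ξ)
      ((m' * (ξ - m t) / v t + v' / 2 * ((ξ - m t) ^ 2 / v t ^ 2 - 1 / v t))
        * gaussianPDFReal (m t) (v t).toNNReal ξ) t := by
  have hev : (fun s => gaussianPDFReal (m s) (v s).toNNReal ξ) =ᶠ[𝓝 t]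
      fun s => (√(2 * Real.pi * v s))⁻¹ * Real.exp (-(ξ - m s) ^ 2 / (2 * v s)) := by
    filter_upwards [hv.continuousAt.eventually (lt_mem_nhds hpos)] with s hs
      using gaussianPDFReal_toNNReal hs ξ
  have h2 : 0 < 2 * Real.pi * v t := by positivity
  have hsq := ((hv.const_mul (2 * Real.pi)).sqrt h2.ne').fun_inv (Real.sqrt_ne_zero'.2 h2)
  have hex := ((((hm.const_sub ξ).fun_pow 2).fun_neg).fun_div (hv.const_mul 2)
    (by positivity : 2 * v t ≠ 0)).exp
  refine ((hsq.fun_mul hex).congr_of_eventuallyEq hev).congr_deriv ?_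
  rw [gaussianPDFReal_toNNReal hpos]
  have hs : √(2 * Real.pi * v t) ^ 2 = 2 * Real.pi * v t := Real.sq_sqrt h2.le
  have hs0 : √(2 * Real.pi * v t) ≠ 0 := Real.sqrt_ne_zero'.2 h2
  rw [hs]
  field_simp
  ring

lemma hasDerivAt_gaussianPDFReal {m v : ℝ} (hv : 0 < v) (z : ℝ) :
    HasDerivAt (gaussianPDFReal m v.toNNReal) (-(z - m) / v * gaussianPDFReal m v.toNNReal z) z := by
  have e : gaussianPDFReal m v.toNNReal =
      fun z => (√(2 * Real.pi * v))⁻¹ * Real.exp (-(z - m) ^ 2 / (2 * v)) :=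
    funext fun z => gaussianPDFReal_toNNReal hv z
  have h := ((((((hasDerivAt_id z).sub_const m).fun_pow 2).fun_neg).div_const (2 * v)).exp).const_mul
    (√(2 * Real.pi * v))⁻¹
  rw [e]
  refine h.congr_deriv ?_
  simp only [id]
  field_simp
  ring

lemma contDiff_gaussianPDFReal (m : ℝ) (v : ℝ≥0) {n : WithTop ℕ∞} :
    ContDiff ℝ n (gaussianPDFReal m v) := by
  rw [gaussianPDFReal_def]
  fun_prop

lemma iteratedDeriv_two_gaussianPDFReal {m v : ℝ} (hv : 0 < v) (c z : ℝ) :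
    iteratedDeriv 2 (fun z => c * gaussianPDFReal m v.toNNReal z) z =
      c * (((z - m) ^ 2 / v ^ 2 - 1 / v) * gaussianPDFReal m v.toNNReal z) := by
  have h1 : deriv (fun z => c * gaussianPDFReal m v.toNNReal z) =
      fun z => c * (-(z - m) / v * gaussianPDFReal m v.toNNReal z) :=
    funext fun z => ((hasDerivAt_gaussianPDFReal hv z).const_mul c).deriv
  rw [iteratedDeriv_succ, iteratedDeriv_one, h1]
  refine HasDerivAt.deriv ?_
  have h2 : HasDerivAt (fun z => -(z - m) / v) (-1 / v) z :=
    (((hasDerivAt_id z).sub_const m).fun_neg).div_const v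
  refine ((h2.fun_mul (hasDerivAt_gaussianPDFReal hv z)).const_mul c).congr_deriv ?_
  field_simp
  ring

lemma hasDerivAt_affine_mul_gaussianPDFReal {m v : ℝ} (hv : 0 < v) {f : ℝ → ℝ} {m' c : ℝ}
    (hf : ∀ z, f z = m' + c * (z - m)) (z : ℝ) :
    HasDerivAt (fun z => f z * gaussianPDFReal m v.toNNReal z)
      ((c - (m' + c * (z - m)) * (z - m) / v) * gaussianPDFReal m v.toNNReal z) z := by
  have h1 : HasDerivAt f c z := by
    rw [funext hf]
    simpa using (((hasDerivAt_id z).sub_const m).const_mul c).const_add m'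
  refine (h1.fun_mul (hasDerivAt_gaussianPDFReal hv z)).congr_deriv ?_
  rw [hf]
  ring

/-- For an affine drift, the Fokker–Planck equation of a Gaussian density in explicit form. -/
lemma fokkerPlanckAt_gaussian_iff_hasDerivAt {m v : ℝ → ℝ} {σ m' c t : ℝ} (hpos : 0 < v t)
    {drift : ℝ → ℝ → ℝ} (hd : ∀ z, drift t z = m' + c * (z - m t)) (ξ : ℝ) :
    FokkerPlanckAt drift σ (fun s z => gaussianPDFReal (m s) (v s).toNNReal z) t ξ ↔
      HasDerivAt (fun s => gaussianPDFReal (m s) (v s).toNNReal ξ)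
        ((m' * (ξ - m t) / v t
            + (2 * c * v t + σ ^ 2) / 2 * ((ξ - m t) ^ 2 / v t ^ 2 - 1 / v t))
          * gaussianPDFReal (m t) (v t).toNNReal ξ) t := by
  have h1 := hasDerivAt_affine_mul_gaussianPDFReal hpos hd ξ
  rw [FokkerPlanckAt, h1.deriv, iteratedDeriv_two_gaussianPDFReal hpos]
  have e : -((c - (m' + c * (ξ - m t)) * (ξ - m t) / v t) * gaussianPDFReal (m t) (v t).toNNReal ξ)
      + 1 / 2 * (σ ^ 2 * (((ξ - m t) ^ 2 / v t ^ 2 - 1 / v t)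
        * gaussianPDFReal (m t) (v t).toNNReal ξ)) =
      (m' * (ξ - m t) / v t
        + (2 * c * v t + σ ^ 2) / 2 * ((ξ - m t) ^ 2 / v t ^ 2 - 1 / v t))
        * gaussianPDFReal (m t) (v t).toNNReal ξ := by
    field_simp
    ring
  rw [e]
  exact ⟨fun h => h.2.2, fun h =>
    ⟨(contDiff_gaussianPDFReal _ _).contDiffAt, h1.differentiableAt, h⟩⟩

/-- The variance is a differentiable function of two values of the Gaussian density. -/
lemma differentiableAt_variance {m v : ℝ → ℝ} {t : ℝ} (hm : DifferentiableAt ℝ m t)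
    (hpos : ∀ᶠ s in 𝓝 t, 0 < v s)
    (h : ∀ ξ, DifferentiableAt ℝ (fun s => gaussianPDFReal (m s) (v s).toNNReal ξ) t) :
    DifferentiableAt ℝ v t := by
  have ht : 0 < v t := hpos.self_of_nhds
  -- In the logarithm of a quotient of two density values the normalization cancels. What remains is
  -- affine in `1 / v s`, with a coefficient equal to `1` at `s = t`, so `v` can be solved for near
  -- `t`.
  set G : ℝ → ℝ := fun s => Real.log (gaussianPDFReal (m s) (v s).toNNReal (m t))
    - Real.log (gaussianPDFReal (m s) (v s).toNNReal (m t + 1)) with hG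
  have hGd : DifferentiableAt ℝ G t :=
    ((h _).log (gaussianPDFReal_toNNReal_pos ht _).ne').sub
      ((h _).log (gaussianPDFReal_toNNReal_pos ht _).ne')
  have hGv : ∀ s, 0 < v s → G s = (1 + 2 * (m t - m s)) / (2 * v s) := fun s hs => by
    have h2 : √(2 * Real.pi * v s) ≠ 0 := Real.sqrt_ne_zero'.2 (by positivity)
    simp only [hG, gaussianPDFReal_toNNReal hs]
    rw [Real.log_mul (inv_ne_zero h2) (Real.exp_ne_zero _),
      Real.log_mul (inv_ne_zero h2) (Real.exp_ne_zero _), Real.log_exp, Real.log_exp]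
    field_simp
    ring
  have hG0 : G t ≠ 0 := by
    rw [hGv t ht, sub_self]
    simpa using ht.ne'
  have hnum : ∀ᶠ s in 𝓝 t, 1 + 2 * (m t - m s) ≠ 0 := by
    have hc : ContinuousAt (fun s => 1 + 2 * (m t - m s)) t := by
      have := hm.continuousAt
      fun_prop
    exact hc.eventually_ne (by simp)
  have hev : v =ᶠ[𝓝 t] fun s => (1 + 2 * (m t - m s)) / (2 * G s) := by
    filter_upwards [hpos, hnum] with s hs hs'
    rw [hGv s hs]
    field_simp
  refine DifferentiableAt.congr_of_eventuallyEq ?_ hev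
  exact DifferentiableAt.fun_div (by fun_prop) (hGd.const_mul 2) (mul_ne_zero two_ne_zero hG0)

/-- For an affine drift, a Gaussian density solves the Fokker–Planck equation if and only if its
variance solves the variance equation. -/
lemma fokkerPlanckAt_gaussian_iff {m v : ℝ → ℝ} {σ m' c t : ℝ} (hm : HasDerivAt m m' t)
    (hpos : ∀ᶠ s in 𝓝 t, 0 < v s) {drift : ℝ → ℝ → ℝ}
    (hd : ∀ z, drift t z = m' + c * (z - m t)) :
    (∀ ξ, FokkerPlanckAt drift σ (fun s z => gaussianPDFReal (m s) (v s).toNNReal z) t ξ) ↔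
      HasDerivAt v (2 * c * v t + σ ^ 2) t := by
  have ht : 0 < v t := hpos.self_of_nhds
  simp_rw [fokkerPlanckAt_gaussian_iff_hasDerivAt ht hd]
  refine ⟨fun h => ?_, fun h ξ => hasDerivAt_gaussianPDFReal_path hm h ht ξ⟩
  have hv := (differentiableAt_variance hm.differentiableAt hpos
    fun ξ => (h ξ).differentiableAt).hasDerivAt
  -- At `ξ = m t` the mean terms vanish and only the coefficient of `-1 / v t` is compared.
  have hu := (hasDerivAt_gaussianPDFReal_path hm hv ht (m t)).unique (h (m t))
  have hp := (gaussianPDFReal_toNNReal_pos (m := m t) ht (m t)).ne'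
  have := mul_right_cancel₀ hp hu
  refine hv.congr_deriv ?_
  simp only [sub_self, ne_eq, OfNat.ofNat_ne_zero, not_false_eq_true, zero_pow, mul_zero, zero_div,
    zero_add, zero_sub] at this
  field_simp at this
  linarith

end FokkerPlanck

/-! ### The variance equation -/

section VarianceEquation

variable {a b σ τ t : ℝ} {φ : ℝ → ℝ}

/-- The variance equation. -/
lemma hasDerivAt_υ (hτ : 0 < τ) (ht : τ < t) : HasDerivAt (υ a b σ τ)
    (2 * a * υ a b σ τ t + 2 * b * r a b σ τ t (-τ) 0 + σ ^ 2) t := by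
  have ht0 : 0 < t := hτ.trans ht
  have hX := intervalIntegrable_X_sq (a := a) (b := b) hτ
  have hXX : ∀ p q, IntervalIntegrable (fun z => X a b τ z * X a b τ (z - τ)) volume p q :=
    fun p q => by simpa [sub_eq_add_neg] using intervalIntegrable_X_mul_X hτ (-τ) p q
  have hc : ContinuousAt (fun q => X a b τ q ^ 2) t :=
    ((continuousOn_X hτ).continuousAt (Ici_mem_nhds ht0)).pow 2
  have h1 : HasDerivAt (fun s => σ ^ 2 * ∫ q in (0 : ℝ)..s, X a b τ q ^ 2)
      (σ ^ 2 * X a b τ t ^ 2) t :=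
    (intervalIntegral.integral_hasDerivAt_right (hX 0 t)
      (((measurable_X hτ).pow_const 2).stronglyMeasurable.stronglyMeasurableAtFilter) hc).const_mul _
  have h2 : υ a b σ τ =ᶠ[𝓝 t] fun s => σ ^ 2 * ∫ q in (0 : ℝ)..s, X a b τ q ^ 2 := by
    filter_upwards [Ioi_mem_nhds ht0] with s hs using υ_eq hs
  refine (h1.congr_of_eventuallyEq h2).congr_deriv ?_
  -- The delayed factor vanishes before `τ`; shifting the rest by `τ` produces the integral in `r`.
  have h3 : ∫ z in (0 : ℝ)..t, X a b τ z * X a b τ (z - τ) =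
      ∫ q in (0 : ℝ)..(t - τ), X a b τ q * X a b τ (q + τ) := by
    rw [← intervalIntegral.integral_add_adjacent_intervals (hXX 0 τ) (hXX τ t)]
    have h4 : ∫ z in (0 : ℝ)..τ, X a b τ z * X a b τ (z - τ) = 0 := by
      refine intervalIntegral.integral_zero_ae ?_
      filter_upwards [compl_mem_ae_iff.2 (measure_singleton τ)] with z hz hz'
      rw [uIoc_of_le hτ.le] at hz'
      rw [X_of_neg (sub_neg.2 (lt_of_le_of_ne hz'.2 hz)), mul_zero]
    have h5 := intervalIntegral.integral_comp_sub_right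
      (fun q => X a b τ q * X a b τ (q + τ)) τ (a := τ) (b := t)
    rw [sub_self] at h5
    rw [h4, zero_add, ← h5]
    refine intervalIntegral.integral_congr fun z _ => ?_
    simp only [sub_add_cancel]
    ring
  have h6 := integral_X_mul_kernel (a := a) (b := b) hτ ht0.le
  have e : ∀ z, 2 * X a b τ z * kernel a b τ z =
      2 * a * X a b τ z ^ 2 + 2 * b * (X a b τ z * X a b τ (z - τ)) := fun z => by
    rw [kernel]; ring
  simp_rw [e] at h6
  rw [intervalIntegral.integral_add ((hX 0 t).const_mul _) ((hXX 0 t).const_mul _),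
    intervalIntegral.integral_const_mul, intervalIntegral.integral_const_mul, h3] at h6
  rw [υ_eq ht0, r_neg_delay_eq hτ ht]
  linear_combination -σ ^ 2 * h6

/-- The constant part is `S'(t)`, so the mean is transported correctly whatever `v` is; the slope
alone enters the variance equation. -/
lemma drift_eq {v : ℝ → ℝ} (z : ℝ) :
    a * z + b * condMean a b σ τ φ v t z =
      (a * S a b τ φ t + b * S a b τ φ (t - τ))
        + (a + b * (r a b σ τ t (-τ) 0 / v t)) * (z - S a b τ φ t) := by
  rw [condMean]; ring

/-- The closed Fokker–Planck equation is equivalent to the variance equation. -/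
lemma fokkerPlanckAt_condMean_iff (hτ : 0 < τ) (hφ : ContinuousOn φ (Icc (-τ) 0)) (ht : τ < t)
    {v : ℝ → ℝ} (hv : ∀ s, τ < s → 0 < v s) :
    (∀ ξ, FokkerPlanckAt (fun s z => a * z + b * condMean a b σ τ φ v s z) σ
        (fun s z => gaussianPDFReal (S a b τ φ s) (v s).toNNReal z) t ξ) ↔
      HasDerivAt v (2 * a * v t + 2 * b * r a b σ τ t (-τ) 0 + σ ^ 2) t := by
  have hev : ∀ᶠ s in 𝓝 t, 0 < v s := by
    filter_upwards [Ioi_mem_nhds ht] with s hs using hv s hs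
  rw [fokkerPlanckAt_gaussian_iff (hasDerivAt_S hτ hφ (hτ.trans ht)) hev fun z => drift_eq z]
  have := (hv t ht).ne'
  rw [show 2 * (a + b * (r a b σ τ t (-τ) 0 / v t)) * v t + σ ^ 2 =
    2 * a * v t + 2 * b * r a b σ τ t (-τ) 0 + σ ^ 2 by field_simp]

end VarianceEquation

/-! ### The joint density and the unclosed evolution equation -/

section JointDensity

variable {a b σ τ t : ℝ} {φ : ℝ → ℝ}

/-- The Schur complement of `υ(t)` in `Q`, which is the variance of the regression residual. -/
lemma υ_sub_sq_div (hσ : σ ≠ 0) (hτ : 0 < τ) (ht : τ < t) :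
    υ a b σ τ (t - τ) - r a b σ τ t (-τ) 0 ^ 2 / υ a b σ τ t =
      (Q a b σ τ t).det / υ a b σ τ t := by
  have hv := (υ_pos (a := a) (b := b) hσ hτ (hτ.trans ht)).ne'
  rw [det_Q]
  field_simp

/-- Factorization of the bivariate density into marginal and conditional densities. -/
lemma pν_eq (hσ : σ ≠ 0) (hτ : 0 < τ) (ht : τ < t) (ξ η : ℝ) :
    pν a b σ τ φ t ξ η = p a b σ τ φ t ξ *
      gaussianPDFReal (condMean a b σ τ φ (υ a b σ τ) t ξ)
        ((Q a b σ τ t).det / υ a b σ τ t).toNNReal η := by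
  have hv := υ_pos (a := a) (b := b) hσ hτ (hτ.trans ht)
  have hD := det_Q_pos (a := a) (b := b) hσ hτ ht
  have hdet := det_Q (a := a) (b := b) (τ := τ) σ t
  rw [p, gaussianPDFReal_toNNReal hv, gaussianPDFReal_toNNReal (div_pos hD hv), condMean]
  have hinv : (Q a b σ τ t)⁻¹ = ((Q a b σ τ t).det)⁻¹ •
      !![υ a b σ τ (t - τ), -r a b σ τ t (-τ) 0; -r a b σ τ t (-τ) 0, υ a b σ τ t] := by
    rw [Matrix.inv_def, Ring.inverse_eq_inv']
    congr 1
    rw [Q, Matrix.adjugate_fin_two_of, r_delay_delay_eq, r_comm σ t 0 (-τ)]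
    simp only [υ]
  simp only [pν]
  rw [hinv]
  set D := (Q a b σ τ t).det
  set v := υ a b σ τ t
  set u := υ a b σ τ (t - τ)
  set c := r a b σ τ t (-τ) 0
  set x := ξ - S a b τ φ t
  have h1 : (2 * Real.pi * √D)⁻¹ = (√(2 * Real.pi * v))⁻¹ * (√(2 * Real.pi * (D / v)))⁻¹ := by
    rw [← mul_inv, ← Real.sqrt_mul (by positivity),
      show 2 * Real.pi * v * (2 * Real.pi * (D / v)) = (2 * Real.pi) ^ 2 * D by field_simp,
      Real.sqrt_mul (by positivity), Real.sqrt_sq (by positivity)]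
  rw [h1, mul_mul_mul_comm, ← Real.exp_add]
  congr 2
  simp [Matrix.mulVec, dotProduct, Fin.sum_univ_two]
  field_simp
  rw [hdet]
  ring

lemma condDensity_eq (hσ : σ ≠ 0) (hτ : 0 < τ) (ht : τ < t) (ξ η : ℝ) :
    condDensity a b σ τ φ t ξ η = gaussianPDFReal (condMean a b σ τ φ (υ a b σ τ) t ξ)
      ((Q a b σ τ t).det / υ a b σ τ t).toNNReal η := by
  rw [condDensity, pν_eq hσ hτ ht, mul_div_cancel_left₀]
  exact (gaussianPDFReal_toNNReal_pos (υ_pos hσ hτ (hτ.trans ht)) _).ne'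

lemma integral_mul_gaussianPDFReal (m : ℝ) {v : ℝ≥0} (hv : v ≠ 0) :
    Integrable (fun η => η * gaussianPDFReal m v η) ∧ ∫ η, η * gaussianPDFReal m v η = m := by
  constructor
  · have h : Integrable id (gaussianReal m v) := IsGaussian.integrable_id
    rw [gaussianReal_of_var_ne_zero _ hv, integrable_withDensity_iff_integrable_smul'
      (measurable_gaussianPDF _ _) (Eventually.of_forall fun _ => gaussianPDF_lt_top)] at h
    simpa [mul_comm] using h
  · have h := integral_gaussianReal_eq_integral_smul (f := id) (μ := m) hv
    simp only [id, integral_id_gaussianReal] at h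
    simpa only [smul_eq_mul, mul_comm] using h.symm

/-- This first moment of the conditional Gaussian is what closes the evolution equation. -/
lemma integral_mul_pν (hσ : σ ≠ 0) (hτ : 0 < τ) (ht : τ < t) (ξ : ℝ) :
    Integrable (fun η => b * η * pν a b σ τ φ t ξ η) ∧
      ∫ η, b * η * pν a b σ τ φ t ξ η =
        b * condMean a b σ τ φ (υ a b σ τ) t ξ * p a b σ τ φ t ξ := by
  have hv := υ_pos (a := a) (b := b) hσ hτ (hτ.trans ht)
  have hD := det_Q_pos (a := a) (b := b) hσ hτ ht
  obtain ⟨h1, h2⟩ := integral_mul_gaussianPDFReal (condMean a b σ τ φ (υ a b σ τ) t ξ)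
    (v := ((Q a b σ τ t).det / υ a b σ τ t).toNNReal) (by simpa using div_pos hD hv)
  have e : (fun η => b * η * pν a b σ τ φ t ξ η) = fun η => b * p a b σ τ φ t ξ *
      (η * gaussianPDFReal (condMean a b σ τ φ (υ a b σ τ) t ξ)
        ((Q a b σ τ t).det / υ a b σ τ t).toNNReal η) := by
    ext η
    rw [pν_eq hσ hτ ht]
    ring
  rw [e]
  refine ⟨h1.const_mul _, ?_⟩
  rw [integral_const_mul, h2]
  ring

/-- The evolution equation of the density in terms of the joint density. -/
lemma hasDerivAt_p (hσ : σ ≠ 0) (hτ : 0 < τ) (hφ : ContinuousOn φ (Icc (-τ) 0)) (ht : τ < t)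
    (ξ : ℝ) : HasDerivAt (fun s => p a b σ τ φ s ξ)
      (-deriv (fun z => a * z * p a b σ τ φ t z) ξ
        - deriv (fun z => ∫ η, b * η * pν a b σ τ φ t z η) ξ
        + 1 / 2 * iteratedDeriv 2 (fun z => σ ^ 2 * p a b σ τ φ t z) ξ) t := by
  have hv := υ_pos (a := a) (b := b) hσ hτ (hτ.trans ht)
  -- The closed equation comes first, from the variance equation; the form with the joint density
  -- only splits its drift term.
  have hFP := (fokkerPlanckAt_condMean_iff hτ hφ ht fun s hs => υ_pos hσ hτ (hτ.trans hs)).2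
    (hasDerivAt_υ (a := a) (b := b) (σ := σ) hτ ht) ξ
  refine hFP.2.2.congr_deriv ?_
  congr 1
  simp_rw [(integral_mul_pν (a := a) (b := b) (φ := φ) hσ hτ ht _).2]
  have h1 : DifferentiableAt ℝ (fun z => a * z * p a b σ τ φ t z) ξ :=
    (hasDerivAt_affine_mul_gaussianPDFReal hv (m := S a b τ φ t) (m' := a * S a b τ φ t) (c := a)
      (fun z => by ring) ξ).differentiableAt
  have h2 : DifferentiableAt ℝ
      (fun z => b * condMean a b σ τ φ (υ a b σ τ) t z * p a b σ τ φ t z) ξ :=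
    (hasDerivAt_affine_mul_gaussianPDFReal hv (m := S a b τ φ t) (m' := b * S a b τ φ (t - τ))
      (c := b * (r a b σ τ t (-τ) 0 / υ a b σ τ t))
      (fun z => by rw [condMean]; ring) ξ).differentiableAt
  rw [← neg_add', ← deriv_fun_add h1 h2]
  simp only [add_mul]
  rfl

end JointDensity

/-! ### Laws of the solution and of the delayed pair -/

section Solution

variable {Ω : Type*} [MeasurableSpace Ω] {P : Measure Ω} {w : ℝ≥0 → Ω → ℝ}
  {a b σ τ : ℝ} {φ : ℝ → ℝ} {x : ℝ → Ω → ℝ}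

lemma covariance_congr_ae {U U' Y Y' : Ω → ℝ} (h : U =ᵐ[P] U') (h' : Y =ᵐ[P] Y') :
    cov[U, Y; P] = cov[U', Y'; P] := by
  rw [covariance, covariance, integral_congr_ae h, integral_congr_ae h']
  refine integral_congr_ae ?_
  filter_upwards [h, h'] with ω h1 h2
  rw [h1, h2]

namespace IsSolution

/-- The variation of constants formula. -/
lemma ae_eq (hx : IsSolution P w a b σ τ φ x) (hw : IsBrownianReal w P) (hτ : 0 < τ)
    (hφ : ContinuousOn φ (Icc (-τ) 0)) {t : ℝ} (ht : -τ ≤ t) :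
    x t =ᵐ[P] fun ω => S a b τ φ t + σ * noise a b τ (path w ω) t := by
  filter_upwards [hx.continuous_paths, hx.initial, hx.eqn, ae_path hw] with ω h1 h2 h3 h4
  refine eq_S_add_noise (y := fun t => x t ω) hτ hφ h4.1 h4.2 h1 h2 (fun s hs => ?_) ht
  lift s to ℝ≥0 using hs
  rw [h3 s, path, Real.toNNReal_coe]

lemma hasGaussianLaw_prodMk [IsProbabilityMeasure P] (hx : IsSolution P w a b σ τ φ x)
    (hw : IsBrownianReal w P) (hτ : 0 < τ) (hφ : ContinuousOn φ (Icc (-τ) 0)) {t t' : ℝ}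
    (ht : -τ ≤ t) (ht' : -τ ≤ t') : HasGaussianLaw (fun ω => (x t ω, x t' ω)) P := by
  have hN := ((isWienerLimit_noise (a := a) (b := b) hw hτ t).hasGaussianLaw_prodMk hw
    (isWienerLimit_noise (a := a) (b := b) hw hτ t')).fun_smul σ
  have hm := hN.aemeasurable
  have := hN.isGaussian_map
  have hS : HasGaussianLaw (fun ω => (S a b τ φ t, S a b τ φ t') +
      σ • (noise a b τ (path w ω) t, noise a b τ (path w ω) t')) P := by
    refine ⟨?_⟩
    rw [show (fun ω => (S a b τ φ t, S a b τ φ t') +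
      σ • (noise a b τ (path w ω) t, noise a b τ (path w ω) t')) =
      (fun z => (S a b τ φ t, S a b τ φ t') + z) ∘
        fun ω => σ • (noise a b τ (path w ω) t, noise a b τ (path w ω) t') from rfl,
      ← AEMeasurable.map_map_of_aemeasurable (by fun_prop) hm]
    infer_instance
  refine hS.congr ?_
  filter_upwards [hx.ae_eq hw hτ hφ ht, hx.ae_eq hw hτ hφ ht'] with ω h1 h2
  rw [h1, h2]
  simp

lemma integral_eq [IsProbabilityMeasure P] (hx : IsSolution P w a b σ τ φ x)
    (hw : IsBrownianReal w P) (hτ : 0 < τ) (hφ : ContinuousOn φ (Icc (-τ) 0)) {t : ℝ}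
    (ht : -τ ≤ t) : P[x t] = S a b τ φ t := by
  have hN := (isWienerLimit_noise (a := a) (b := b) hw hτ t).hasLaw hw
  rw [integral_congr_ae (hx.ae_eq hw hτ hφ ht), integral_add (integrable_const _)
    (hN.hasGaussianLaw.integrable.const_mul σ), integral_const_mul, hN.integral_eq,
    integral_id_gaussianReal]
  simp

lemma covariance_eq [IsProbabilityMeasure P] (hx : IsSolution P w a b σ τ φ x)
    (hw : IsBrownianReal w P) (hτ : 0 < τ) (hφ : ContinuousOn φ (Icc (-τ) 0)) {t s₁ s₂ : ℝ}
    (h₁ : -τ ≤ t + s₁) (h₂ : -τ ≤ t + s₂) :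
    cov[x (t + s₁), x (t + s₂); P] = r a b σ τ t s₁ s₂ := by
  have hU := isWienerLimit_noise (P := P) (a := a) (b := b) hw hτ (t + s₁)
  have hV := isWienerLimit_noise (P := P) (a := a) (b := b) hw hτ (t + s₂)
  rw [covariance_congr_ae (hx.ae_eq hw hτ hφ h₁) (hx.ae_eq hw hτ hφ h₂),
    covariance_const_add_left ((hU.hasLaw hw).hasGaussianLaw.integrable.const_mul σ),
    covariance_const_add_right ((hV.hasLaw hw).hasGaussianLaw.integrable.const_mul σ),
    covariance_const_mul_left, covariance_const_mul_right, r_eq_integral,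
    hU.covariance_eq hw hV (by simpa [sq] using integrableOn_X_sub_mul hτ (t + s₁) (t + s₁))
      (by simpa [sq] using integrableOn_X_sub_mul hτ (t + s₂) (t + s₂))
      (integrableOn_X_sub_mul hτ _ _)]
  ring

lemma variance_eq [IsProbabilityMeasure P] (hx : IsSolution P w a b σ τ φ x)
    (hw : IsBrownianReal w P) (hτ : 0 < τ) (hφ : ContinuousOn φ (Icc (-τ) 0)) {t : ℝ}
    (ht : -τ ≤ t) : Var[x t; P] = υ a b σ τ t := by
  rw [← covariance_self (hx.measurable t ht).aemeasurable]
  simpa [υ] using hx.covariance_eq hw hτ hφ (t := t) (s₁ := 0) (s₂ := 0) (by simpa) (by simpa)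

lemma covariance_delay_eq [IsProbabilityMeasure P] (hx : IsSolution P w a b σ τ φ x)
    (hw : IsBrownianReal w P) (hτ : 0 < τ) (hφ : ContinuousOn φ (Icc (-τ) 0)) {t : ℝ}
    (ht : 0 ≤ t) : cov[x t, x (t - τ); P] = r a b σ τ t (-τ) 0 := by
  rw [r_comm]
  simpa [sub_eq_add_neg] using
    hx.covariance_eq hw hτ hφ (t := t) (s₁ := 0) (s₂ := -τ) (by linarith) (by linarith)

lemma map_eq [IsProbabilityMeasure P] (hx : IsSolution P w a b σ τ φ x)
    (hw : IsBrownianReal w P) (hσ : σ ≠ 0) (hτ : 0 < τ) (hφ : ContinuousOn φ (Icc (-τ) 0))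
    {t : ℝ} (ht : 0 < t) :
    P.map (x t) = volume.withDensity fun ξ => ENNReal.ofReal (p a b σ τ φ t ξ) := by
  have ht' : -τ ≤ t := by linarith
  rw [(hx.hasGaussianLaw_prodMk hw hτ hφ ht' ht').fst.map_eq_gaussianReal,
    hx.integral_eq hw hτ hφ ht', hx.variance_eq hw hτ hφ ht',
    gaussianReal_of_var_ne_zero _ (by simpa using υ_pos hσ hτ ht)]
  rfl

lemma map_prodMk_eq [IsProbabilityMeasure P] (hx : IsSolution P w a b σ τ φ x)
    (hw : IsBrownianReal w P) (hσ : σ ≠ 0) (hτ : 0 < τ) (hφ : ContinuousOn φ (Icc (-τ) 0))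
    {t : ℝ} (ht : τ < t) :
    P.map (fun ω => (x t ω, x (t - τ) ω)) =
      volume.withDensity fun z : ℝ × ℝ => ENNReal.ofReal (pν a b σ τ φ t z.1 z.2) := by
  have ht1 : -τ ≤ t := by linarith
  have ht2 : -τ ≤ t - τ := by linarith
  have hv := υ_pos (a := a) (b := b) hσ hτ (hτ.trans ht)
  have he := υ_sub_sq_div (a := a) (b := b) hσ hτ ht
  rw [map_prodMk_of_hasGaussianLaw (hx.hasGaussianLaw_prodMk hw hτ hφ ht1 ht2)
    (hx.integral_eq hw hτ hφ ht1) (hx.integral_eq hw hτ hφ ht2) (hx.variance_eq hw hτ hφ ht1)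
    (hx.covariance_delay_eq hw hτ hφ (hτ.trans ht).le) (hx.variance_eq hw hτ hφ ht2) hv
    (by rw [he]; exact div_pos (det_Q_pos hσ hτ ht) hv), he]
  simp_rw [pν_eq hσ hτ ht]
  rfl

lemma condExp_eq [IsProbabilityMeasure P] (hx : IsSolution P w a b σ τ φ x)
    (hw : IsBrownianReal w P) (hσ : σ ≠ 0) (hτ : 0 < τ) (hφ : ContinuousOn φ (Icc (-τ) 0))
    {t : ℝ} (ht : τ < t) :
    P[x (t - τ) | MeasurableSpace.comap (x t) inferInstance] =ᵐ[P]
      fun ω => condMean a b σ τ φ (υ a b σ τ) t (x t ω) := by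
  have ht1 : -τ ≤ t := by linarith
  have ht2 : -τ ≤ t - τ := by linarith
  exact condExp_of_hasGaussianLaw (hx.hasGaussianLaw_prodMk hw hτ hφ ht1 ht2)
    (hx.integral_eq hw hτ hφ ht1) (hx.integral_eq hw hτ hφ ht2) (hx.variance_eq hw hτ hφ ht1)
    (hx.covariance_delay_eq hw hτ hφ (hτ.trans ht).le) (hx.variance_eq hw hτ hφ ht2)
    (υ_pos hσ hτ (hτ.trans ht)) (hx.measurable t ht1) (hx.measurable _ ht2)

/-- The pair of the present and the delayed state has a density exactly after time `τ`. -/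
lemma hasPDF_prodMk_iff [IsProbabilityMeasure P] (hx : IsSolution P w a b σ τ φ x)
    (hw : IsBrownianReal w P) (hσ : σ ≠ 0) (hτ : 0 < τ) (hφ : ContinuousOn φ (Icc (-τ) 0))
    {t : ℝ} (ht : 0 ≤ t) : HasPDF (fun ω => (x t ω, x (t - τ) ω)) P volume ↔ τ < t := by
  have hm : Measurable fun ω => (x t ω, x (t - τ) ω) :=
    (hx.measurable t (by linarith)).prodMk (hx.measurable (t - τ) (by linarith))
  constructor
  · intro hpdf
    by_contra! h
    -- For `t ≤ τ` the delayed time lies in the initial interval, so the pair is concentrated on a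
    -- line of Lebesgue measure zero.
    have hs : MeasurableSet (univ ×ˢ {φ (t - τ)} : Set (ℝ × ℝ)) :=
      MeasurableSet.univ.prod (measurableSet_singleton _)
    have h0 : (volume : Measure (ℝ × ℝ)) (univ ×ˢ {φ (t - τ)}) = 0 := by
      rw [Measure.volume_eq_prod, Measure.prod_prod]
      simp
    have h1 := hpdf.absolutelyContinuous' h0
    rw [Measure.map_apply hm hs] at h1
    have h2 : ∀ᵐ ω ∂P, ω ∈ (fun ω => (x t ω, x (t - τ) ω)) ⁻¹' (univ ×ˢ {φ (t - τ)}) := by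
      filter_upwards [hx.initial] with ω hω
      simpa using hω (t - τ) ⟨by linarith, by linarith⟩
    rw [prob_compl_eq_zero_iff₀ (hm hs).nullMeasurableSet |>.1 (ae_iff.1 h2)] at h1
    exact one_ne_zero h1
  · intro h
    refine hasPDF_of_map_eq_withDensity hm.aemeasurable _ ?_ (hx.map_prodMk_eq hw hσ hτ hφ h)
    refine (ENNReal.measurable_ofReal.comp ?_).aemeasurable
    simp_rw [pν_eq (a := a) (b := b) (φ := φ) hσ hτ h, p]
    unfold gaussianPDFReal condMean
    fun_prop

end IsSolution

end Solution

end LinearSDDE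

/-! ### The main theorem -/

theorem mainTheorem3 {Ω : Type*} [MeasurableSpace Ω] (P : Measure Ω) [IsProbabilityMeasure P]
    (w : ℝ≥0 → Ω → ℝ) (hw : IsBrownianReal w P)
    (a b σ τ : ℝ) (hσ : σ ≠ 0) (hτ : 0 < τ)
    (φ : ℝ → ℝ) (hφ : ContinuousOn φ (Icc (-τ) 0))
    (x : ℝ → Ω → ℝ) (hx : LinearSDDE.IsSolution P w a b σ τ φ x) :
    -- `X` is the fundamental solution of the noiseless equation
    ((∀ t < 0, LinearSDDE.X a b τ t = 0) ∧ LinearSDDE.X a b τ 0 = 1 ∧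
      ContinuousOn (LinearSDDE.X a b τ) (Ici 0) ∧
      ∀ t, 0 < t → t ≠ τ → HasDerivAt (LinearSDDE.X a b τ)
        (a * LinearSDDE.X a b τ t + b * LinearSDDE.X a b τ (t - τ)) t) ∧
    -- `S` is the solution of the noiseless equation with initial function `φ`
    ((∀ t ∈ Icc (-τ) 0, LinearSDDE.S a b τ φ t = φ t) ∧
      ContinuousOn (LinearSDDE.S a b τ φ) (Ici (-τ)) ∧
      ∀ t, 0 < t → HasDerivAt (LinearSDDE.S a b τ φ)
        (a * LinearSDDE.S a b τ φ t + b * LinearSDDE.S a b τ φ (t - τ)) t) ∧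
    -- mean and covariance of the solution
    (∀ t, -τ ≤ t → P[x t] = LinearSDDE.S a b τ φ t) ∧
    (∀ t, 0 ≤ t → ∀ s₁ ∈ Icc (-τ) 0, ∀ s₂ ∈ Icc (-τ) 0,
      cov[x (t + s₁), x (t + s₂); P] = LinearSDDE.r a b σ τ t s₁ s₂) ∧
    -- `x(t)` has the Gaussian density `p(·, t)` for every `t > 0`
    (∀ t, 0 < t → 0 < LinearSDDE.υ a b σ τ t ∧
      P.map (x t) = volume.withDensity (fun ξ => ENNReal.ofReal (LinearSDDE.p a b σ τ φ t ξ))) ∧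
    -- `(x(t), x(t - τ))` is Gaussian, and has a density exactly when `t > τ`
    (∀ t, 0 ≤ t → HasGaussianLaw (fun ω => (x t ω, x (t - τ) ω)) P ∧
      (HasPDF (fun ω => (x t ω, x (t - τ) ω)) P volume ↔ τ < t) ∧
      (t ≤ τ → (LinearSDDE.Q a b σ τ t).det = 0)) ∧
    (∀ t, τ < t →
      -- the Cauchy-Schwarz bound on the covariance, nondegeneracy, and the joint density
      LinearSDDE.r a b σ τ t (-τ) 0 ^ 2
        ≤ LinearSDDE.υ a b σ τ (t - τ) * (LinearSDDE.υ a b σ τ t - LinearSDDE.υ a b σ τ τ) ∧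
      LinearSDDE.υ a b σ τ (t - τ) * (LinearSDDE.υ a b σ τ t - LinearSDDE.υ a b σ τ τ)
        < LinearSDDE.υ a b σ τ (t - τ) * LinearSDDE.υ a b σ τ t ∧
      0 < (LinearSDDE.Q a b σ τ t).det ∧
      P.map (fun ω => (x t ω, x (t - τ) ω)) = volume.withDensity
        (fun z : ℝ × ℝ => ENNReal.ofReal (LinearSDDE.pν a b σ τ φ t z.1 z.2)) ∧
      -- the conditional density is Gaussian with mean `m_|`, the conditional mean
      (∀ ξ η, LinearSDDE.condDensity a b σ τ φ t ξ η =
        gaussianPDFReal (LinearSDDE.condMean a b σ τ φ (LinearSDDE.υ a b σ τ) t ξ)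
          ((LinearSDDE.Q a b σ τ t).det / LinearSDDE.υ a b σ τ t).toNNReal η) ∧
      (P[x (t - τ) | MeasurableSpace.comap (x t) inferInstance] =ᵐ[P]
        fun ω => LinearSDDE.condMean a b σ τ φ (LinearSDDE.υ a b σ τ) t (x t ω)) ∧
      -- the evolution equation in terms of the joint density, and the closed equation
      (∀ ξ, Integrable (fun η => b * η * LinearSDDE.pν a b σ τ φ t ξ η) ∧
        HasDerivAt (fun s => LinearSDDE.p a b σ τ φ s ξ)
          (-deriv (fun z => a * z * LinearSDDE.p a b σ τ φ t z) ξ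
            - deriv (fun z => ∫ η, b * η * LinearSDDE.pν a b σ τ φ t z η) ξ
            + 1 / 2 * iteratedDeriv 2 (fun z => σ ^ 2 * LinearSDDE.p a b σ τ φ t z) ξ) t) ∧
      (∀ ξ, LinearSDDE.FokkerPlanckAt
        (fun s z => a * z + b * LinearSDDE.condMean a b σ τ φ (LinearSDDE.υ a b σ τ) s z) σ
        (LinearSDDE.p a b σ τ φ) t ξ) ∧
      -- the variance equation, and its equivalence with the closed equation: among all Gaussian
      -- densities with mean `S_t φ (0)` and positive variance `v(t)`, the closed equation singles
      -- out those whose variance satisfies the variance equation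
      HasDerivAt (LinearSDDE.υ a b σ τ)
        (2 * a * LinearSDDE.υ a b σ τ t + 2 * b * LinearSDDE.r a b σ τ t (-τ) 0 + σ ^ 2) t ∧
      ∀ v : ℝ → ℝ, (∀ s, τ < s → 0 < v s) →
        ((∀ ξ, LinearSDDE.FokkerPlanckAt
            (fun s z => a * z + b * LinearSDDE.condMean a b σ τ φ v s z) σ
            (fun s z => gaussianPDFReal (LinearSDDE.S a b τ φ s) (v s).toNNReal z) t ξ) ↔
          HasDerivAt v (2 * a * v t + 2 * b * LinearSDDE.r a b σ τ t (-τ) 0 + σ ^ 2) t)) := by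

  refine ⟨⟨fun t ht => LinearSDDE.X_of_neg ht, LinearSDDE.X_zero, LinearSDDE.continuousOn_X hτ,
      fun t ht htτ => LinearSDDE.hasDerivAt_X hτ ht.ne' htτ⟩,
    ⟨fun t ht => LinearSDDE.S_eq_initial hτ hφ ht, LinearSDDE.continuousOn_S hτ hφ,
      fun t ht => LinearSDDE.hasDerivAt_S hτ hφ ht⟩,
    fun t ht => hx.integral_eq hw hτ hφ ht,
    fun t ht s₁ h₁ s₂ h₂ => hx.covariance_eq hw hτ hφ (by linarith [h₁.1]) (by linarith [h₂.1]),
    fun t ht => ⟨LinearSDDE.υ_pos hσ hτ ht, hx.map_eq hw hσ hτ hφ ht⟩,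
    fun t ht => ⟨hx.hasGaussianLaw_prodMk hw hτ hφ (by linarith) (by linarith),
      hx.hasPDF_prodMk_iff hw hσ hτ hφ ht, fun htτ => ?_⟩,
    fun t ht => ⟨LinearSDDE.r_sq_le hτ ht, ?_, LinearSDDE.det_Q_pos hσ hτ ht,
      hx.map_prodMk_eq hw hσ hτ hφ ht, fun ξ η => LinearSDDE.condDensity_eq hσ hτ ht ξ η,
      hx.condExp_eq hw hσ hτ hφ ht,
      fun ξ => ⟨(LinearSDDE.integral_mul_pν hσ hτ ht ξ).1, LinearSDDE.hasDerivAt_p hσ hτ hφ ht ξ⟩,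
      (LinearSDDE.fokkerPlanckAt_condMean_iff hτ hφ ht fun s hs =>
        LinearSDDE.υ_pos hσ hτ (hτ.trans hs)).2 (LinearSDDE.hasDerivAt_υ hτ ht),
      LinearSDDE.hasDerivAt_υ hτ ht,
      fun v hv => LinearSDDE.fokkerPlanckAt_condMean_iff hτ hφ ht hv⟩⟩
  -- For `t ≤ τ` both the covariance and `υ(t - τ)` are zero by the default value of `r`.
  · rw [LinearSDDE.det_Q, LinearSDDE.r_of_nonpos (by rw [min_eq_left (by linarith)]; linarith),
      LinearSDDE.υ, LinearSDDE.υ,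
      LinearSDDE.r_of_nonpos (t := t - τ) (by rw [min_self]; linarith)]
    simp
  -- Strictness is the positivity of the product `υ(t - τ) υ(τ)`.
  · have h1 := LinearSDDE.υ_pos (a := a) (b := b) hσ hτ (sub_pos.2 ht)
    have h2 := LinearSDDE.υ_pos (a := a) (b := b) hσ hτ hτ
    nlinarith
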